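/- **The $\lambda\ell$-calculus.** Types are given by $\tau,\sigma ::= \mathbb{o} \mid \tau\multimap\sigma \mid \tau\otimes\sigma \mid \mathbf{I} \mid \tau\to\sigma \mid \tau\mathbin{\&}\sigma \mid \tau\oplus\sigma \mid \top \mid 0$. Terms, taken up to renaming of bound variables, are $$t,u,v ::= x \mid \lambda x.t \mid \lambda^! x.t \mid t\,u \mid t\otimes u \mid () \mid \mathsf{let}\ p = t\ \mathsf{in}\ u \mid \langle t,u\rangle \mid \pi_i(t) \mid \mathsf{in}_i(t) \mid \mathsf{case}(t,x.u,y.v) \mid \langle\rangle \mid \mathsf{abort}(t),$$ where $i\in\{1,2\}$ and a pattern $p$ is either $()$ or $x\otimes y$ (binding $x,y$ in $u$). A judgment $\Psi;\Delta\vdash t:\tau$ involves a finite non-linear context $\Psi$ and a finite linear context $\Delta$ with disjoint sets of variables; $\Delta,\Delta'$ denotes a union of contexts with disjoint sets of variables, and $\cdot$ the empty context. The typing rules are: - $\Psi;x:\tau\vdash x:\tau$ and $\Psi,x:\tau;\cdot\vdash x:\tau$; - from $\Psi;\Delta,x:\tau\vdash t:\sigma$ infer $\Psi;\Delta\vdash\lambda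 x.t:\tau\multimap\sigma$; from $\Psi,x:\tau;\Delta\vdash t:\sigma$ infer $\Psi;\Delta\vdash\lambda^!x.t:\tau\to\sigma$; - from $\Psi;\Delta\vdash t:\tau\multimap\sigma$ and $\Psi;\Delta'\vdash u:\tau$ infer $\Psi;\Delta,\Delta'\vdash t\,u:\sigma$; from $\Psi;\Delta\vdash t:\tau\to\sigma$ and $\Psi;\cdot\vdash u:\tau$ infer $\Psi;\Delta\vdash t\,u:\sigma$; - from $\Psi;\Delta\vdash t:\tau$ and $\Psi;\Delta'\vdash u:\sigma$ infer $\Psi;\Delta,\Delta'\vdash t\otimes u:\tau\otimes\sigma$; from $\Psi;\Delta'\vdash t:\tau\otimes\sigma$ and $\Psi;\Delta,x:\tau,y:\sigma\vdash u:\kappa$ infer $\Psi;\Delta,\Delta'\vdash\mathsf{let}\ x\otimes y=t\ \mathsf{in}\ u:\kappa$; - $\Psi;\cdot\vdash():\mathbf{I}$; from $\Psi;\Delta'\vdash t:\mathbf{I}$ and $\Psi;\Delta\vdash u:\kappa$ infer $\Psi;\Delta,\Delta'\vdash\mathsf{let}\ ()=t\ \mathsf{in}\ u:\kappa$; - from $\Psi;\Delta\vdash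 t:\tau$ and $\Psi;\Delta\vdash u:\sigma$ infer $\Psi;\Delta\vdash\langle t,u\rangle:\tau\mathbin{\&}\sigma$; from $\Psi;\Delta\vdash t:\tau_1\mathbin{\&}\tau_2$ infer $\Psi;\Delta\vdash\pi_i(t):\tau_i$; - from $\Psi;\Delta\vdash t:\tau_i$ infer $\Psi;\Delta\vdash\mathsf{in}_i(t):\tau_1\oplus\tau_2$; from $\Psi;\Delta\vdash t:\tau\oplus\sigma$, $\Psi;\Delta',x:\tau\vdash u:\kappa$ and $\Psi;\Delta',y:\sigma\vdash v:\kappa$ infer $\Psi;\Delta,\Delta'\vdash\mathsf{case}(t,x.u,y.v):\kappa$; - $\Psi;\Delta\vdash\langle\rangle:\top$; from $\Psi;\Delta\vdash t:0$ infer $\Psi;\Delta,\Delta'\vdash\mathsf{abort}(t):\tau$. **Reduction.** $\to_\beta$ is the closure under congruence of $(\lambda x.t)\,u\to t[u/x]$; $(\lambda^!x.t)\,u\to t[u/x]$; $\pi_i(\langle t_1,t_2\rangle)\to t_i$; $\mathsf{case}(\mathsf{in}_1(t),x.u,y.v)\to u[t/x]$; $\mathsf{case}(\mathsf{in}_2(t),x.u,y.v)\to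 v[t/y]$; $\mathsf{let}\ x\otimes y=t\otimes u\ \mathsf{in}\ v\to v[t/x][u/y]$; $\mathsf{let}\ ()=()\ \mathsf{in}\ t\to t$. The extrusion relation $\to_{\mathsf{extr}}$ is the closure under congruence of all the rules $$E[\mathsf{let}\ p=t\ \mathsf{in}\ u]\to\mathsf{let}\ p=t\ \mathsf{in}\ E[u],\qquad E[\mathsf{abort}(t)]\to\mathsf{abort}(t),\qquad E[\mathsf{case}(t,x.u,y.v)]\to\mathsf{case}(t,x.E[u],y.E[v]),$$ where $E[\,]$ is any of the five forms $[\,]\,w$; $\pi_i([\,])$; $\mathsf{let}\ q=[\,]\ \mathsf{in}\ w$; $\mathsf{abort}([\,])$; $\mathsf{case}([\,],x'.w,y'.w')$, and bound variables are renamed so that no variable is captured. Terms related by a reduction step are required to have the same type in the same context. $\to^*_{\beta\mathsf{extr}}$ is the reflexive transitive closure of $\to_\beta\cup\to_{\mathsf{extr}}$. **Normal forms.** The judgments $\Psi;\Delta\vdash_{\mathrm{NE}}t:\tau$ (neutral) and $\Psi;\Delta\vdash_{\mathrm{NF}}t:\tau$ (normal) are defined by simultaneous induction: every neutral term is normal;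 and each typing rule above is taken with the following annotations. - Variables are neutral. - The rules for $\lambda x.t$, $\lambda^!x.t$, $t\otimes u$, $()$, $\langle t,u\rangle$, $\mathsf{in}_i(t)$, $\langle\rangle$ have all premises and the conclusion in $\mathrm{NF}$. - Both rules for $t\,u$ have the premise on $t$ in $\mathrm{NE}$, the premise on $u$ in $\mathrm{NF}$, and the conclusion in $\mathrm{NE}$. - The rules for $\pi_i(t)$ and $\mathsf{abort}(t)$ have premise and conclusion in $\mathrm{NE}$. - The rules for $\mathsf{let}\ p=t\ \mathsf{in}\ u$ and $\mathsf{case}(t,x.u,y.v)$ have the premise on $t$ in $\mathrm{NE}$, and, for each $X\in\{\mathrm{NE},\mathrm{NF}\}$, the other premises and the conclusion in $X$. **Theorem (normalization).** For all $\Psi,\Delta,t,\tau$ such that $\Psi;\Delta\vdash t:\tau$, there exists a term $t'$ such that $t\to^*_{\beta\mathsf{extr}}t'$ and $\Psi;\Delta\vdash_{\mathrm{NF}}t':\tau$. -/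

import Mathlib

/-! The `λℓ`-calculus: a linear λ-calculus over intuitionistic multiplicative-additive linear logic,
with a non-linear arrow.  Terms are taken up to renaming of bound variables, by means of
de Bruijn indices. -/

namespace LamL

/-- Types: `𝕠`, `τ ⊸ σ`, `τ ⊗ σ`, `I`, `τ → σ`, `τ & σ`, `τ ⊕ σ`, `⊤` and `0`. -/
inductive Ty : Type
  | base : Ty
  | lolli : Ty → Ty → Ty
  | tensor : Ty → Ty → Ty
  | one : Ty
  | arrow : Ty → Ty → Ty
  | amp : Ty → Ty → Ty
  | plus : Ty → Ty → Ty
  | top : Ty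
  | zero : Ty

/-- The index `i = 1, 2` of `π_i` and `in_i`. -/
inductive Side : Type
  | fst : Side
  | snd : Side

/-- The patterns `()` and `x ⊗ y` of the `let` construction. -/
inductive Pat : Type
  | unit : Pat
  | tens : Pat

/-- The number of variables bound by a pattern. -/
def Pat.arity : Pat → ℕ
  | .unit => 0
  | .tens => 2

/-- Raw terms.  `var n` is the variable bound by the `n`-th enclosing binder, or the free variable
found in the corresponding place of the context. -/
inductive Tm : Type
  | var : ℕ → Tm
  /-- `λx. t` (linear abstraction) -/
  | lam : Tm → Tm
  /-- `λ! x. t` (non-linear abstraction) -/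
  | lamBang : Tm → Tm
  /-- `t u` (both the linear and the non-linear application) -/
  | app : Tm → Tm → Tm
  /-- `t ⊗ u` -/
  | tens : Tm → Tm → Tm
  /-- `()` -/
  | unit : Tm
  /-- `let p = t in u`; for `p = x ⊗ y`, in `u` the variable `y` has index `0` and `x` has
  index `1` -/
  | letIn : Pat → Tm → Tm → Tm
  /-- `⟨t, u⟩` -/
  | pair : Tm → Tm → Tm
  /-- `π_i(t)` -/
  | proj : Side → Tm → Tm
  /-- `in_i(t)` -/
  | inj : Side → Tm → Tm
  /-- `case(t, x.u, y.v)`; one variable is bound in `u` and one in `v` -/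
  | caseOf : Tm → Tm → Tm → Tm
  /-- `⟨⟩` -/
  | triv : Tm
  /-- `abort(t)` -/
  | abort : Tm → Tm

/-! ### Renaming and capture-avoiding substitution -/

/-- Extend a renaming under one binder. -/
def liftRen (ρ : ℕ → ℕ) : ℕ → ℕ
  | 0 => 0
  | n + 1 => ρ n + 1

/-- Renaming of the free variables. -/
def Tm.ren : (ℕ → ℕ) → Tm → Tm
  | ρ, .var n => .var (ρ n)
  | ρ, .lam t => .lam (t.ren (liftRen ρ))
  | ρ, .lamBang t => .lamBang (t.ren (liftRen ρ))
  | ρ, .app t u => .app (t.ren ρ) (u.ren ρ)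
  | ρ, .tens t u => .tens (t.ren ρ) (u.ren ρ)
  | _, .unit => .unit
  | ρ, .letIn p t u => .letIn p (t.ren ρ) (u.ren (liftRen^[p.arity] ρ))
  | ρ, .pair t u => .pair (t.ren ρ) (u.ren ρ)
  | ρ, .proj i t => .proj i (t.ren ρ)
  | ρ, .inj i t => .inj i (t.ren ρ)
  | ρ, .caseOf t u v => .caseOf (t.ren ρ) (u.ren (liftRen ρ)) (v.ren (liftRen ρ))
  | _, .triv => .triv
  | ρ, .abort t => .abort (t.ren ρ)

/-- Extend a substitution under one binder. -/
def liftSub (s : ℕ → Tm) : ℕ → Tm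
  | 0 => .var 0
  | n + 1 => (s n).ren Nat.succ

/-- Simultaneous capture-avoiding substitution. -/
def Tm.sub : (ℕ → Tm) → Tm → Tm
  | s, .var n => s n
  | s, .lam t => .lam (t.sub (liftSub s))
  | s, .lamBang t => .lamBang (t.sub (liftSub s))
  | s, .app t u => .app (t.sub s) (u.sub s)
  | s, .tens t u => .tens (t.sub s) (u.sub s)
  | _, .unit => .unit
  | s, .letIn p t u => .letIn p (t.sub s) (u.sub (liftSub^[p.arity] s))
  | s, .pair t u => .pair (t.sub s) (u.sub s)
  | s, .proj i t => .proj i (t.sub s)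
  | s, .inj i t => .inj i (t.sub s)
  | s, .caseOf t u v => .caseOf (t.sub s) (u.sub (liftSub s)) (v.sub (liftSub s))
  | _, .triv => .triv
  | s, .abort t => .abort (t.sub s)

/-- The substitution that sends the variable `0` to `u` and lowers the others by one. -/
def consSub (u : Tm) (s : ℕ → Tm) : ℕ → Tm
  | 0 => u
  | n + 1 => s n

/-- `t[u/x]`, where `x` is the variable `0` of `t`. -/
def Tm.inst (t u : Tm) : Tm := t.sub (consSub u Tm.var)

/-- `v[t/x][u/y]`, where `y` is the variable `0` and `x` the variable `1` of `v`. -/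
def Tm.inst₂ (v t u : Tm) : Tm := v.sub (consSub u (consSub t Tm.var))

/-- Move `t` under `k` additional binders. -/
def Tm.shift (k : ℕ) (t : Tm) : Tm := t.ren (fun n => n + k)

/-- Move `t`, whose variables `0, …, m - 1` are bound just outside of `t`, under `k` additional
binders which lie outside of those `m` ones. -/
def Tm.shiftAbove (m k : ℕ) (t : Tm) : Tm := t.ren (liftRen^[m] (fun n => n + k))

/-! ### Contexts and typing -/

/-- A place of a context `Ψ; Δ`: a variable declared in the non-linear context `Ψ`, or a variable
declared in the linear context `Δ`, or a variable which is in neither of them. -/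
inductive Decl : Type
  | nonlin : Ty → Decl
  | lin : Ty → Decl
  | absent : Decl

/-- A pair `Ψ; Δ` of finite contexts with disjoint sets of variables: the declaration of the
variable `n` is at the position `n` of the list. -/
abbrev Ctx : Type := List Decl

/-- `Δ` is empty. -/
def Ctx.NoLin (Γ : Ctx) : Prop := ∀ τ : Ty, Decl.lin τ ∉ Γ

/-- Remove a declaration if it is linear. -/
def Decl.dropLin : Decl → Decl
  | .lin _ => .absent
  | d => d

/-- From `Ψ; Δ` to `Ψ; ·`. -/
def Ctx.dropLin (Γ : Ctx) : Ctx := Γ.map Decl.dropLin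

/-- `Split Γ Γ₁ Γ₂` means: `Γ`, `Γ₁`, `Γ₂` are `Ψ; Δ, Δ'` and `Ψ; Δ` and `Ψ; Δ'` for some `Ψ` and
some `Δ`, `Δ'` with disjoint sets of variables. -/
inductive Split : Ctx → Ctx → Ctx → Prop
  | nil : Split [] [] []
  | nonlin {Γ Γ₁ Γ₂ : Ctx} (τ : Ty) :
      Split Γ Γ₁ Γ₂ → Split (.nonlin τ :: Γ) (.nonlin τ :: Γ₁) (.nonlin τ :: Γ₂)
  | left {Γ Γ₁ Γ₂ : Ctx} (τ : Ty) :
      Split Γ Γ₁ Γ₂ → Split (.lin τ :: Γ) (.lin τ :: Γ₁) (.absent :: Γ₂)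
  | right {Γ Γ₁ Γ₂ : Ctx} (τ : Ty) :
      Split Γ Γ₁ Γ₂ → Split (.lin τ :: Γ) (.absent :: Γ₁) (.lin τ :: Γ₂)
  | absent {Γ Γ₁ Γ₂ : Ctx} :
      Split Γ Γ₁ Γ₂ → Split (.absent :: Γ) (.absent :: Γ₁) (.absent :: Γ₂)

/-- `Γ` is `Ψ; x : τ`, where `x` is the variable `n`. -/
def Ctx.IsLinVar (Γ : Ctx) (n : ℕ) (τ : Ty) : Prop :=
  Γ[n]? = some (.lin τ) ∧ ∀ (m : ℕ) (σ : Ty), Γ[m]? = some (.lin σ) → m = n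

/-- `Γ` is `Ψ, x : τ; ·`, where `x` is the variable `n`. -/
def Ctx.IsNonlinVar (Γ : Ctx) (n : ℕ) (τ : Ty) : Prop :=
  Γ[n]? = some (.nonlin τ) ∧ Γ.NoLin

/-- The typing judgment `Ψ; Δ ⊢ t : τ`. -/
inductive Typed : Ctx → Tm → Ty → Prop
  | linVar {Γ : Ctx} {n : ℕ} {τ : Ty} : Γ.IsLinVar n τ → Typed Γ (.var n) τ
  | nonlinVar {Γ : Ctx} {n : ℕ} {τ : Ty} : Γ.IsNonlinVar n τ → Typed Γ (.var n) τ
  | lam {Γ : Ctx} {t : Tm} {τ σ : Ty} :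
      Typed (.lin τ :: Γ) t σ → Typed Γ (.lam t) (.lolli τ σ)
  | linApp {Γ Γ₁ Γ₂ : Ctx} {t u : Tm} {τ σ : Ty} :
      Split Γ Γ₁ Γ₂ → Typed Γ₁ t (.lolli τ σ) → Typed Γ₂ u τ → Typed Γ (.app t u) σ
  | lamBang {Γ : Ctx} {t : Tm} {τ σ : Ty} :
      Typed (.nonlin τ :: Γ) t σ → Typed Γ (.lamBang t) (.arrow τ σ)
  | nonlinApp {Γ : Ctx} {t u : Tm} {τ σ : Ty} :
      Typed Γ t (.arrow τ σ) → Typed Γ.dropLin u τ → Typed Γ (.app t u) σ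
  | tens {Γ Γ₁ Γ₂ : Ctx} {t u : Tm} {τ σ : Ty} :
      Split Γ Γ₁ Γ₂ → Typed Γ₁ t τ → Typed Γ₂ u σ → Typed Γ (.tens t u) (.tensor τ σ)
  | letTens {Γ Γ₁ Γ₂ : Ctx} {t u : Tm} {τ σ κ : Ty} :
      Split Γ Γ₁ Γ₂ → Typed Γ₁ t (.tensor τ σ) → Typed (.lin σ :: .lin τ :: Γ₂) u κ →
      Typed Γ (.letIn .tens t u) κ
  | unit {Γ : Ctx} : Γ.NoLin → Typed Γ .unit .one
  | letUnit {Γ Γ₁ Γ₂ : Ctx} {t u : Tm} {κ : Ty} :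
      Split Γ Γ₁ Γ₂ → Typed Γ₁ t .one → Typed Γ₂ u κ → Typed Γ (.letIn .unit t u) κ
  | pair {Γ : Ctx} {t u : Tm} {τ σ : Ty} :
      Typed Γ t τ → Typed Γ u σ → Typed Γ (.pair t u) (.amp τ σ)
  | fst {Γ : Ctx} {t : Tm} {τ σ : Ty} : Typed Γ t (.amp τ σ) → Typed Γ (.proj .fst t) τ
  | snd {Γ : Ctx} {t : Tm} {τ σ : Ty} : Typed Γ t (.amp τ σ) → Typed Γ (.proj .snd t) σ
  | inl {Γ : Ctx} {t : Tm} {τ σ : Ty} : Typed Γ t τ → Typed Γ (.inj .fst t) (.plus τ σ)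
  | inr {Γ : Ctx} {t : Tm} {τ σ : Ty} : Typed Γ t σ → Typed Γ (.inj .snd t) (.plus τ σ)
  | caseOf {Γ Γ₁ Γ₂ : Ctx} {t u v : Tm} {τ σ κ : Ty} :
      Split Γ Γ₁ Γ₂ → Typed Γ₁ t (.plus τ σ) → Typed (.lin τ :: Γ₂) u κ →
      Typed (.lin σ :: Γ₂) v κ → Typed Γ (.caseOf t u v) κ
  | triv {Γ : Ctx} : Typed Γ .triv .top
  | abort {Γ Γ₁ Γ₂ : Ctx} {t : Tm} {τ : Ty} :
      Split Γ Γ₁ Γ₂ → Typed Γ₁ t .zero → Typed Γ (.abort t) τ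

/-! ### Reduction -/

/-- The β-redexes and their contracta. -/
inductive BetaRule : Tm → Tm → Prop
  | lam (t u : Tm) : BetaRule (.app (.lam t) u) (t.inst u)
  | lamBang (t u : Tm) : BetaRule (.app (.lamBang t) u) (t.inst u)
  | fst (t u : Tm) : BetaRule (.proj .fst (.pair t u)) t
  | snd (t u : Tm) : BetaRule (.proj .snd (.pair t u)) u
  | inl (t u v : Tm) : BetaRule (.caseOf (.inj .fst t) u v) (u.inst t)
  | inr (t u v : Tm) : BetaRule (.caseOf (.inj .snd t) u v) (v.inst t)
  | letTens (t u v : Tm) : BetaRule (.letIn .tens (.tens t u) v) (v.inst₂ t u)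
  | letUnit (t : Tm) : BetaRule (.letIn .unit .unit t) t

/-- The extrusion rules: an eliminator of `⊗`, `I`, `0` or `⊕` is moved out of the principal
position of another eliminator. -/
inductive ExtrRule : Tm → Tm → Prop
  | letApp (p : Pat) (t u v : Tm) :
      ExtrRule (.app (.letIn p t u) v) (.letIn p t (.app u (v.shift p.arity)))
  | letProj (i : Side) (p : Pat) (t u : Tm) :
      ExtrRule (.proj i (.letIn p t u)) (.letIn p t (.proj i u))
  | letLet (p q : Pat) (t u v : Tm) :
      ExtrRule (.letIn q (.letIn p t u) v)
        (.letIn p t (.letIn q u (v.shiftAbove q.arity p.arity)))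
  | letAbort (p : Pat) (t u : Tm) :
      ExtrRule (.abort (.letIn p t u)) (.letIn p t (.abort u))
  | letCase (p : Pat) (t u v w : Tm) :
      ExtrRule (.caseOf (.letIn p t u) v w)
        (.letIn p t (.caseOf u (v.shiftAbove 1 p.arity) (w.shiftAbove 1 p.arity)))
  | abortApp (t u : Tm) : ExtrRule (.app (.abort t) u) (.abort t)
  | abortProj (i : Side) (t : Tm) : ExtrRule (.proj i (.abort t)) (.abort t)
  | abortLet (p : Pat) (t u : Tm) : ExtrRule (.letIn p (.abort t) u) (.abort t)
  | abortAbort (t : Tm) : ExtrRule (.abort (.abort t)) (.abort t)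
  | abortCase (t u v : Tm) : ExtrRule (.caseOf (.abort t) u v) (.abort t)
  | caseApp (t u v w : Tm) :
      ExtrRule (.app (.caseOf t u v) w) (.caseOf t (.app u (w.shift 1)) (.app v (w.shift 1)))
  | caseProj (i : Side) (t u v : Tm) :
      ExtrRule (.proj i (.caseOf t u v)) (.caseOf t (.proj i u) (.proj i v))
  | caseLet (p : Pat) (t u v w : Tm) :
      ExtrRule (.letIn p (.caseOf t u v) w)
        (.caseOf t (.letIn p u (w.shiftAbove p.arity 1)) (.letIn p v (w.shiftAbove p.arity 1)))
  | caseAbort (t u v : Tm) :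
      ExtrRule (.abort (.caseOf t u v)) (.caseOf t (.abort u) (.abort v))
  | caseCase (t u v u' v' : Tm) :
      ExtrRule (.caseOf (.caseOf t u v) u' v')
        (.caseOf t (.caseOf u (u'.shiftAbove 1 1) (v'.shiftAbove 1 1))
          (.caseOf v (u'.shiftAbove 1 1) (v'.shiftAbove 1 1)))

/-- Closure of a relation under congruence: one use of `R`, at an arbitrary place of the term. -/
inductive CongClosure (R : Tm → Tm → Prop) : Tm → Tm → Prop
  | rule {t t' : Tm} : R t t' → CongClosure R t t'
  | lam {t t' : Tm} : CongClosure R t t' → CongClosure R (.lam t) (.lam t')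
  | lamBang {t t' : Tm} : CongClosure R t t' → CongClosure R (.lamBang t) (.lamBang t')
  | appL {t t' : Tm} (u : Tm) : CongClosure R t t' → CongClosure R (.app t u) (.app t' u)
  | appR (t : Tm) {u u' : Tm} : CongClosure R u u' → CongClosure R (.app t u) (.app t u')
  | tensL {t t' : Tm} (u : Tm) : CongClosure R t t' → CongClosure R (.tens t u) (.tens t' u)
  | tensR (t : Tm) {u u' : Tm} : CongClosure R u u' → CongClosure R (.tens t u) (.tens t u')
  | letL (p : Pat) {t t' : Tm} (u : Tm) :
      CongClosure R t t' → CongClosure R (.letIn p t u) (.letIn p t' u)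
  | letR (p : Pat) (t : Tm) {u u' : Tm} :
      CongClosure R u u' → CongClosure R (.letIn p t u) (.letIn p t u')
  | pairL {t t' : Tm} (u : Tm) : CongClosure R t t' → CongClosure R (.pair t u) (.pair t' u)
  | pairR (t : Tm) {u u' : Tm} : CongClosure R u u' → CongClosure R (.pair t u) (.pair t u')
  | proj (i : Side) {t t' : Tm} : CongClosure R t t' → CongClosure R (.proj i t) (.proj i t')
  | inj (i : Side) {t t' : Tm} : CongClosure R t t' → CongClosure R (.inj i t) (.inj i t')
  | case₁ {t t' : Tm} (u v : Tm) :
      CongClosure R t t' → CongClosure R (.caseOf t u v) (.caseOf t' u v)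
  | case₂ (t : Tm) {u u' : Tm} (v : Tm) :
      CongClosure R u u' → CongClosure R (.caseOf t u v) (.caseOf t u' v)
  | case₃ (t u : Tm) {v v' : Tm} :
      CongClosure R v v' → CongClosure R (.caseOf t u v) (.caseOf t u v')
  | abort {t t' : Tm} : CongClosure R t t' → CongClosure R (.abort t) (.abort t')

/-- `t →_β t'`. -/
def Beta : Tm → Tm → Prop := CongClosure BetaRule

/-- `t →_extr t'`. -/
def Extr : Tm → Tm → Prop := CongClosure ExtrRule

/-- One reduction step (β or extrusion) between terms of the same type in the same context. -/
def Step (Γ : Ctx) (τ : Ty) (t t' : Tm) : Prop :=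
  Typed Γ t τ ∧ Typed Γ t' τ ∧ (Beta t t' ∨ Extr t t')

/-- The reflexive transitive closure of `Step`. -/
def Reduces (Γ : Ctx) (τ : Ty) : Tm → Tm → Prop := Relation.ReflTransGen (Step Γ τ)

/-! ### Normal and neutral terms -/

/-- The two kinds of judgment, `⊢_NE` (neutral terms) and `⊢_NF` (normal terms). -/
inductive Kind : Type
  | ne : Kind
  | nf : Kind

/-- `Norm .ne Γ t τ` is `Ψ; Δ ⊢_NE t : τ` and `Norm .nf Γ t τ` is `Ψ; Δ ⊢_NF t : τ`. -/
inductive Norm : Kind → Ctx → Tm → Ty → Prop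
  | ofNe {Γ : Ctx} {t : Tm} {τ : Ty} : Norm .ne Γ t τ → Norm .nf Γ t τ
  | linVar {Γ : Ctx} {n : ℕ} {τ : Ty} : Γ.IsLinVar n τ → Norm .ne Γ (.var n) τ
  | nonlinVar {Γ : Ctx} {n : ℕ} {τ : Ty} : Γ.IsNonlinVar n τ → Norm .ne Γ (.var n) τ
  | lam {Γ : Ctx} {t : Tm} {τ σ : Ty} :
      Norm .nf (.lin τ :: Γ) t σ → Norm .nf Γ (.lam t) (.lolli τ σ)
  | linApp {Γ Γ₁ Γ₂ : Ctx} {t u : Tm} {τ σ : Ty} :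
      Split Γ Γ₁ Γ₂ → Norm .ne Γ₁ t (.lolli τ σ) → Norm .nf Γ₂ u τ → Norm .ne Γ (.app t u) σ
  | lamBang {Γ : Ctx} {t : Tm} {τ σ : Ty} :
      Norm .nf (.nonlin τ :: Γ) t σ → Norm .nf Γ (.lamBang t) (.arrow τ σ)
  | nonlinApp {Γ : Ctx} {t u : Tm} {τ σ : Ty} :
      Norm .ne Γ t (.arrow τ σ) → Norm .nf Γ.dropLin u τ → Norm .ne Γ (.app t u) σ
  | tens {Γ Γ₁ Γ₂ : Ctx} {t u : Tm} {τ σ : Ty} :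
      Split Γ Γ₁ Γ₂ → Norm .nf Γ₁ t τ → Norm .nf Γ₂ u σ → Norm .nf Γ (.tens t u) (.tensor τ σ)
  | letTens {X : Kind} {Γ Γ₁ Γ₂ : Ctx} {t u : Tm} {τ σ κ : Ty} :
      Split Γ Γ₁ Γ₂ → Norm .ne Γ₁ t (.tensor τ σ) → Norm X (.lin σ :: .lin τ :: Γ₂) u κ →
      Norm X Γ (.letIn .tens t u) κ
  | unit {Γ : Ctx} : Γ.NoLin → Norm .nf Γ .unit .one
  | letUnit {X : Kind} {Γ Γ₁ Γ₂ : Ctx} {t u : Tm} {κ : Ty} :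
      Split Γ Γ₁ Γ₂ → Norm .ne Γ₁ t .one → Norm X Γ₂ u κ → Norm X Γ (.letIn .unit t u) κ
  | pair {Γ : Ctx} {t u : Tm} {τ σ : Ty} :
      Norm .nf Γ t τ → Norm .nf Γ u σ → Norm .nf Γ (.pair t u) (.amp τ σ)
  | fst {Γ : Ctx} {t : Tm} {τ σ : Ty} : Norm .ne Γ t (.amp τ σ) → Norm .ne Γ (.proj .fst t) τ
  | snd {Γ : Ctx} {t : Tm} {τ σ : Ty} : Norm .ne Γ t (.amp τ σ) → Norm .ne Γ (.proj .snd t) σ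
  | inl {Γ : Ctx} {t : Tm} {τ σ : Ty} : Norm .nf Γ t τ → Norm .nf Γ (.inj .fst t) (.plus τ σ)
  | inr {Γ : Ctx} {t : Tm} {τ σ : Ty} : Norm .nf Γ t σ → Norm .nf Γ (.inj .snd t) (.plus τ σ)
  | caseOf {X : Kind} {Γ Γ₁ Γ₂ : Ctx} {t u v : Tm} {τ σ κ : Ty} :
      Split Γ Γ₁ Γ₂ → Norm .ne Γ₁ t (.plus τ σ) → Norm X (.lin τ :: Γ₂) u κ →
      Norm X (.lin σ :: Γ₂) v κ → Norm X Γ (.caseOf t u v) κ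
  | triv {Γ : Ctx} : Norm .nf Γ .triv .top
  | abort {Γ Γ₁ Γ₂ : Ctx} {t : Tm} {τ : Ty} :
      Split Γ Γ₁ Γ₂ → Norm .ne Γ₁ t .zero → Norm .ne Γ (.abort t) τ

end LamL

namespace LamL

/-! ### Algebra of renamings and substitutions -/

/-! Typing is set aside and reducibility is defined on raw terms; only weak normalization is at
stake, so no strong normalization or confluence argument is needed. Linearity plays no role there:
both arrows get the same reducibility clause up to the abstraction constructor.

The difficulty is that a `let` or `case` over a neutral scrutinee may end in introduction forms, so
it is neither neutral nor a value. Reducible terms are therefore the closure `Cl (Val τ)`: trees of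
such `let` and `case` whose leaves are neutral or values, closed under expansion. Extrusion pushes
an eliminator `E[ ]` through the tree to its leaves; there it meets a neutral term, or a value on
which a β-step fires. This is `Cl.plug`, and it reduces each elimination case of the fundamental
lemma `Typed.red` to those two situations. As pushing `E[ ]` under binders renames it, all
predicates are stable under renaming, and function values are tested in every renaming.

Since variables are neutral, the identity substitution is reducible, so a typed term is reducible
and hence reduces to a term with the shape of a normal form (`Red.wn`). Typing returns at the end:
subject reduction (`Typed.beta`, `Typed.extr`) makes every step of the untyped sequence a typed one
(`Typed.reduces`), and a typed term of normal shape is normal (`Shape.norm`). Subject reduction is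
where linear resources must be tracked, through splittings of contexts. -/

theorem liftRen_comp (ρ ρ' : ℕ → ℕ) : liftRen ρ' ∘ liftRen ρ = liftRen (ρ' ∘ ρ) := by
  funext n; cases n <;> rfl

theorem liftSub_comp_liftRen (s : ℕ → Tm) (ρ : ℕ → ℕ) :
    liftSub s ∘ liftRen ρ = liftSub (s ∘ ρ) := by
  funext n; cases n <;> rfl

theorem liftSub_var : liftSub Tm.var = Tm.var := by
  funext n; cases n <;> rfl

theorem Tm.ren_ren (t : Tm) (ρ ρ' : ℕ → ℕ) : (t.ren ρ).ren ρ' = t.ren (ρ' ∘ ρ) := by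
  induction t generalizing ρ ρ' with
  | letIn p t u iht ihu => cases p <;> simp [Tm.ren, iht, ihu, Pat.arity, liftRen_comp]
  | _ => simp_all [Tm.ren, liftRen_comp]

theorem Tm.sub_ren (t : Tm) (ρ : ℕ → ℕ) (s : ℕ → Tm) : (t.ren ρ).sub s = t.sub (s ∘ ρ) := by
  induction t generalizing ρ s with
  | letIn p t u iht ihu =>
    cases p <;> simp [Tm.ren, Tm.sub, iht, ihu, Pat.arity, liftSub_comp_liftRen]
  | _ => simp_all [Tm.ren, Tm.sub, liftSub_comp_liftRen]

theorem liftSub_ren (s : ℕ → Tm) (ρ : ℕ → ℕ) :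
    (fun n => (liftSub s n).ren (liftRen ρ)) = liftSub (fun n => (s n).ren ρ) := by
  funext n
  cases n with
  | zero => rfl
  | succ n => simp only [liftSub, Tm.ren_ren]; rfl

theorem Tm.ren_sub (t : Tm) (s : ℕ → Tm) (ρ : ℕ → ℕ) :
    (t.sub s).ren ρ = t.sub (fun n => (s n).ren ρ) := by
  induction t generalizing ρ s with
  | letIn p t u iht ihu =>
    cases p <;> simp [Tm.ren, Tm.sub, iht, ihu, Pat.arity, liftSub_ren]
  | _ => simp_all [Tm.ren, Tm.sub, liftSub_ren]

theorem liftSub_sub (s s' : ℕ → Tm) :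
    (fun n => (liftSub s n).sub (liftSub s')) = liftSub (fun n => (s n).sub s') := by
  funext n
  cases n with
  | zero => rfl
  | succ n => simp only [liftSub, Tm.sub_ren, Tm.ren_sub]; rfl

theorem Tm.sub_sub (t : Tm) (s s' : ℕ → Tm) :
    (t.sub s).sub s' = t.sub (fun n => (s n).sub s') := by
  induction t generalizing s s' with
  | letIn p t u iht ihu =>
    cases p <;> simp [Tm.sub, iht, ihu, Pat.arity, liftSub_sub]
  | _ => simp_all [Tm.sub, liftSub_sub]

theorem Tm.sub_var (t : Tm) : t.sub Tm.var = t := by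
  induction t with
  | letIn p t u iht ihu => cases p <;> simp [Tm.sub, iht, ihu, Pat.arity, liftSub_var]
  | _ => simp_all [Tm.sub, liftSub_var]

theorem Tm.ren_inst (t u : Tm) (ρ : ℕ → ℕ) :
    (t.inst u).ren ρ = (t.ren (liftRen ρ)).inst (u.ren ρ) := by
  simp only [Tm.inst, Tm.ren_sub, Tm.sub_ren]
  congr 1; funext n; cases n <;> rfl

theorem Tm.ren_inst₂ (v t u : Tm) (ρ : ℕ → ℕ) :
    (v.inst₂ t u).ren ρ = (v.ren (liftRen (liftRen ρ))).inst₂ (t.ren ρ) (u.ren ρ) := by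
  simp only [Tm.inst₂, Tm.ren_sub, Tm.sub_ren]
  congr 1; funext n
  match n with
  | 0 => rfl
  | 1 => rfl
  | _ + 2 => rfl

theorem liftRen_iterate_comp (m : ℕ) (ρ ρ' : ℕ → ℕ) :
    liftRen^[m] ρ' ∘ liftRen^[m] ρ = liftRen^[m] (ρ' ∘ ρ) := by
  induction m generalizing ρ ρ' with
  | zero => rfl
  | succ m ih => simp only [Function.iterate_succ_apply, ih, liftRen_comp]

theorem liftRen_iterate_add (k : ℕ) (ρ : ℕ → ℕ) (n : ℕ) :
    liftRen^[k] ρ (n + k) = ρ n + k := by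
  induction k with
  | zero => rfl
  | succ k ih => rw [Function.iterate_succ_apply', ← Nat.add_assoc]; simp only [liftRen, ih]; rfl

theorem Tm.shift_ren (t : Tm) (k : ℕ) (ρ : ℕ → ℕ) :
    (t.shift k).ren (liftRen^[k] ρ) = (t.ren ρ).shift k := by
  simp only [Tm.shift, Tm.ren_ren]
  congr 1; funext n; exact liftRen_iterate_add k ρ n

theorem Tm.shiftAbove_ren (t : Tm) (m k : ℕ) (ρ : ℕ → ℕ) :
    (t.shiftAbove m k).ren (liftRen^[m] (liftRen^[k] ρ)) =
      (t.ren (liftRen^[m] ρ)).shiftAbove m k := by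
  simp only [Tm.shiftAbove, Tm.ren_ren, liftRen_iterate_comp]
  congr 2; funext n; exact liftRen_iterate_add k ρ n

/-! ### Untyped reduction -/

/-- A β-redex or an extrusion redex, with its contractum. -/
def Rule (t t' : Tm) : Prop := BetaRule t t' ∨ ExtrRule t t'

/-- A derivation of a congruence step contains a single use of the rule, so the choice between the
two relations can be moved outside. Untyped arguments use one closure of `Rule`, whereas `Step`
keeps β and extrusion apart. -/
theorem CongClosure.of_or {R S : Tm → Tm → Prop} {t t' : Tm}
    (ht : CongClosure (fun a b => R a b ∨ S a b) t t') :
    CongClosure R t t' ∨ CongClosure S t t' := by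
  induction ht with
  | rule hr => exact hr.imp .rule .rule
  | lam _ ih => exact ih.imp .lam .lam
  | lamBang _ ih => exact ih.imp .lamBang .lamBang
  | appL _ _ ih => exact ih.imp (.appL _) (.appL _)
  | appR _ _ ih => exact ih.imp (.appR _) (.appR _)
  | tensL _ _ ih => exact ih.imp (.tensL _) (.tensL _)
  | tensR _ _ ih => exact ih.imp (.tensR _) (.tensR _)
  | letL _ _ _ ih => exact ih.imp (.letL _ _) (.letL _ _)
  | letR _ _ _ ih => exact ih.imp (.letR _ _) (.letR _ _)
  | pairL _ _ ih => exact ih.imp (.pairL _) (.pairL _)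
  | pairR _ _ ih => exact ih.imp (.pairR _) (.pairR _)
  | proj _ _ ih => exact ih.imp (.proj _) (.proj _)
  | inj _ _ ih => exact ih.imp (.inj _) (.inj _)
  | case₁ _ _ _ ih => exact ih.imp (.case₁ _ _) (.case₁ _ _)
  | case₂ _ _ _ ih => exact ih.imp (.case₂ _ _) (.case₂ _ _)
  | case₃ _ _ _ ih => exact ih.imp (.case₃ _ _) (.case₃ _ _)
  | abort _ ih => exact ih.imp .abort .abort

theorem BetaRule.ren {t t' : Tm} (h : BetaRule t t') (ρ : ℕ → ℕ) :
    BetaRule (t.ren ρ) (t'.ren ρ) := by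
  cases h <;> simp only [Tm.ren, Tm.ren_inst, Tm.ren_inst₂, Pat.arity, Function.iterate_succ_apply,
    Function.iterate_zero_apply] <;> constructor

theorem ExtrRule.ren {t t' : Tm} (h : ExtrRule t t') (ρ : ℕ → ℕ) :
    ExtrRule (t.ren ρ) (t'.ren ρ) := by
  -- The general shift lemmas speak of `liftRen^[k]`; these instances rewrite the numeral cases to
  -- plain `liftRen`, the form in which `Tm.ren` produces them.
  have h1 (t : Tm) : (t.shift 1).ren (liftRen ρ) = (t.ren ρ).shift 1 := t.shift_ren 1 ρ
  have h2 (t : Tm) (m : ℕ) : (t.shiftAbove m 1).ren (liftRen^[m] (liftRen ρ)) =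
      (t.ren (liftRen^[m] ρ)).shiftAbove m 1 := t.shiftAbove_ren m 1 ρ
  have h3 (t : Tm) (k : ℕ) : (t.shiftAbove 1 k).ren (liftRen (liftRen^[k] ρ)) =
      (t.ren (liftRen ρ)).shiftAbove 1 k := t.shiftAbove_ren 1 k ρ
  have h4 (t : Tm) : (t.shiftAbove 1 1).ren (liftRen (liftRen ρ)) =
      (t.ren (liftRen ρ)).shiftAbove 1 1 := t.shiftAbove_ren 1 1 ρ
  cases h <;> simp only [Tm.ren, Tm.shift_ren, Tm.shiftAbove_ren, h1, h2, h3, h4] <;> constructor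

theorem CongClosure.ren {R : Tm → Tm → Prop}
    (hR : ∀ t t' (ρ : ℕ → ℕ), R t t' → R (t.ren ρ) (t'.ren ρ)) {t t' : Tm}
    (h : CongClosure R t t') (ρ : ℕ → ℕ) : CongClosure R (t.ren ρ) (t'.ren ρ) := by
  induction h generalizing ρ with
  | rule hr => exact .rule (hR _ _ _ hr)
  | lam _ ih => exact .lam (ih _)
  | lamBang _ ih => exact .lamBang (ih _)
  | appL _ _ ih => exact .appL _ (ih _)
  | appR _ _ ih => exact .appR _ (ih _)
  | tensL _ _ ih => exact .tensL _ (ih _)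
  | tensR _ _ ih => exact .tensR _ (ih _)
  | letL _ _ _ ih => exact .letL _ _ (ih _)
  | letR _ _ _ ih => exact .letR _ _ (ih _)
  | pairL _ _ ih => exact .pairL _ (ih _)
  | pairR _ _ ih => exact .pairR _ (ih _)
  | proj _ _ ih => exact .proj _ (ih _)
  | inj _ _ ih => exact .inj _ (ih _)
  | case₁ _ _ _ ih => exact .case₁ _ _ (ih _)
  | case₂ _ _ _ ih => exact .case₂ _ _ (ih _)
  | case₃ _ _ _ ih => exact .case₃ _ _ (ih _)
  | abort _ ih => exact .abort (ih _)

theorem Rule.ren {t t' : Tm} (h : Rule t t') (ρ : ℕ → ℕ) : Rule (t.ren ρ) (t'.ren ρ) :=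
  h.imp (·.ren ρ) (·.ren ρ)

/-! ### Elimination frames -/

/-- The forms of `E[ ]` in the extrusion rules. -/
inductive Frame : Type
  | app : Tm → Frame
  | proj : Side → Frame
  | letIn : Pat → Tm → Frame
  | abort : Frame
  | caseOf : Tm → Tm → Frame

/-- `E[t]`. -/
def Frame.plug : Frame → Tm → Tm
  | .app w, t => .app t w
  | .proj i, t => .proj i t
  | .letIn p w, t => .letIn p t w
  | .abort, t => .abort t
  | .caseOf v w, t => .caseOf t v w

/-- Renaming of the free variables of a frame. -/
def Frame.ren : Frame → (ℕ → ℕ) → Frame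
  | .app w, ρ => .app (w.ren ρ)
  | .proj i, _ => .proj i
  | .letIn p w, ρ => .letIn p (w.ren (liftRen^[p.arity] ρ))
  | .abort, _ => .abort
  | .caseOf v w, ρ => .caseOf (v.ren (liftRen ρ)) (w.ren (liftRen ρ))

theorem Tm.ren_eq_sub (t : Tm) (ρ : ℕ → ℕ) : t.ren ρ = t.sub (fun n => .var (ρ n)) := by
  conv_lhs => rw [← t.sub_var, Tm.ren_sub]
  rfl

theorem Tm.ren_id (t : Tm) : t.ren id = t := (t.ren_eq_sub id).trans t.sub_var

theorem liftRen_id : liftRen id = id := by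
  funext n; cases n <;> rfl

theorem Frame.ren_id (F : Frame) : F.ren id = F := by
  cases F with
  | letIn p w => cases p <;> simp [Frame.ren, Pat.arity, liftRen_id, Tm.ren_id]
  | _ => simp [Frame.ren, liftRen_id, Tm.ren_id]

theorem Frame.ren_ren (F : Frame) (ρ ρ' : ℕ → ℕ) : (F.ren ρ).ren ρ' = F.ren (ρ' ∘ ρ) := by
  cases F <;> simp [Frame.ren, Tm.ren_ren, liftRen_comp, liftRen_iterate_comp]

theorem CongClosure.plug {R : Tm → Tm → Prop} (F : Frame) {t t' : Tm} (h : CongClosure R t t') :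
    CongClosure R (F.plug t) (F.plug t') := by
  cases F with
  | app w => exact .appL w h
  | proj i => exact .proj i h
  | letIn p w => exact .letL p w h
  | abort => exact .abort h
  | caseOf v w => exact .case₁ v w h

/-- The extrusion rules, written with frames. -/
inductive FrameExtr : Tm → Tm → Prop
  | letIn (F : Frame) (p : Pat) (t u : Tm) :
      FrameExtr (F.plug (.letIn p t u)) (.letIn p t ((F.ren (fun n => n + p.arity)).plug u))
  | abort (F : Frame) (t : Tm) : FrameExtr (F.plug (.abort t)) (.abort t)
  | caseOf (F : Frame) (t u v : Tm) :
      FrameExtr (F.plug (.caseOf t u v))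
        (.caseOf t ((F.ren (fun n => n + 1)).plug u) ((F.ren (fun n => n + 1)).plug v))

/-- The fifteen extrusion rules are three schemes at five frames: renaming a frame unfolds to
`shift` or `shiftAbove` on its components. -/
theorem FrameExtr.extrRule {t t' : Tm} (h : FrameExtr t t') : ExtrRule t t' := by
  cases h with
  | letIn F p t u => cases F <;> constructor
  | abort F t => cases F <;> constructor
  | caseOf F t u v => cases F <;> constructor

theorem ExtrRule.frameExtr {t t' : Tm} (h : ExtrRule t t') : FrameExtr t t' := by
  cases h with
  | letApp p t u v => exact .letIn (.app v) p t u
  | letProj i p t u => exact .letIn (.proj i) p t u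
  | letLet p q t u v => exact .letIn (.letIn q v) p t u
  | letAbort p t u => exact .letIn .abort p t u
  | letCase p t u v w => exact .letIn (.caseOf v w) p t u
  | abortApp t u => exact .abort (.app u) t
  | abortProj i t => exact .abort (.proj i) t
  | abortLet p t u => exact .abort (.letIn p u) t
  | abortAbort t => exact .abort .abort t
  | abortCase t u v => exact .abort (.caseOf u v) t
  | caseApp t u v w => exact .caseOf (.app w) t u v
  | caseProj i t u v => exact .caseOf (.proj i) t u v
  | caseLet p t u v w => exact .caseOf (.letIn p w) t u v
  | caseAbort t u v => exact .caseOf .abort t u v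
  | caseCase t u v u' v' => exact .caseOf (.caseOf u' v') t u v

/-! ### Structural normal forms -/

/-- The shapes of neutral and of normal terms, without typing. -/
inductive Shape : Kind → Tm → Prop
  | ofNe {t : Tm} : Shape .ne t → Shape .nf t
  | var (n : ℕ) : Shape .ne (.var n)
  | lam {t : Tm} : Shape .nf t → Shape .nf (.lam t)
  | lamBang {t : Tm} : Shape .nf t → Shape .nf (.lamBang t)
  | app {t u : Tm} : Shape .ne t → Shape .nf u → Shape .ne (.app t u)
  | tens {t u : Tm} : Shape .nf t → Shape .nf u → Shape .nf (.tens t u)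
  | unit : Shape .nf .unit
  | letIn {X : Kind} {p : Pat} {t u : Tm} : Shape .ne t → Shape X u → Shape X (.letIn p t u)
  | pair {t u : Tm} : Shape .nf t → Shape .nf u → Shape .nf (.pair t u)
  | proj {i : Side} {t : Tm} : Shape .ne t → Shape .ne (.proj i t)
  | inj {i : Side} {t : Tm} : Shape .nf t → Shape .nf (.inj i t)
  | caseOf {X : Kind} {t u v : Tm} :
      Shape .ne t → Shape X u → Shape X v → Shape X (.caseOf t u v)
  | triv : Shape .nf .triv
  | abort {t : Tm} : Shape .ne t → Shape .ne (.abort t)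

theorem Shape.ren {X : Kind} {t : Tm} (h : Shape X t) (ρ : ℕ → ℕ) : Shape X (t.ren ρ) := by
  induction h generalizing ρ with
  | ofNe _ ih => exact .ofNe (ih ρ)
  | var n => exact .var _
  | lam _ ih => exact .lam (ih _)
  | lamBang _ ih => exact .lamBang (ih _)
  | app _ _ iht ihu => exact .app (iht _) (ihu _)
  | tens _ _ iht ihu => exact .tens (iht _) (ihu _)
  | unit => exact .unit
  | letIn _ _ iht ihu => exact .letIn (iht _) (ihu _)
  | pair _ _ iht ihu => exact .pair (iht _) (ihu _)
  | proj _ ih => exact .proj (ih _)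
  | inj _ ih => exact .inj (ih _)
  | caseOf _ _ _ iht ihu ihv => exact .caseOf (iht _) (ihu _) (ihv _)
  | triv => exact .triv
  | abort _ ih => exact .abort (ih _)

/-- A typed term with the shape of a normal (neutral) term is normal (neutral). -/
theorem Shape.norm {X : Kind} {t : Tm} (h : Shape X t) {Γ : Ctx} {τ : Ty} (ht : Typed Γ t τ) :
    Norm X Γ t τ := by
  induction h generalizing Γ τ with
  | ofNe _ ih => exact .ofNe (ih ht)
  | var n =>
    cases ht with
    | linVar h => exact .linVar h
    | nonlinVar h => exact .nonlinVar h
  | lam _ ih => cases ht with | lam h => exact .lam (ih h)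
  | lamBang _ ih => cases ht with | lamBang h => exact .lamBang (ih h)
  | app _ _ iht ihu =>
    cases ht with
    | linApp hs h1 h2 => exact .linApp hs (iht h1) (ihu h2)
    | nonlinApp h1 h2 => exact .nonlinApp (iht h1) (ihu h2)
  | tens _ _ iht ihu => cases ht with | tens hs h1 h2 => exact .tens hs (iht h1) (ihu h2)
  | unit => cases ht with | unit h => exact .unit h
  | letIn _ _ iht ihu =>
    cases ht with
    | letTens hs h1 h2 => exact .letTens hs (iht h1) (ihu h2)
    | letUnit hs h1 h2 => exact .letUnit hs (iht h1) (ihu h2)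
  | pair _ _ iht ihu => cases ht with | pair h1 h2 => exact .pair (iht h1) (ihu h2)
  | proj _ ih =>
    cases ht with
    | fst h => exact .fst (ih h)
    | snd h => exact .snd (ih h)
  | inj _ ih =>
    cases ht with
    | inl h => exact .inl (ih h)
    | inr h => exact .inr (ih h)
  | caseOf _ _ _ iht ihu ihv =>
    cases ht with | caseOf hs h1 h2 h3 => exact .caseOf hs (iht h1) (ihu h2) (ihv h3)
  | triv => cases ht; exact .triv
  | abort _ ih => cases ht with | abort hs h => exact .abort hs (ih h)

/-! ### Splitting of contexts -/

theorem Split.comm {Γ Γ₁ Γ₂ : Ctx} (h : Split Γ Γ₁ Γ₂) : Split Γ Γ₂ Γ₁ := by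
  induction h <;> constructor <;> assumption

/-- Disjoint union of linear contexts is associative, place by place. This is what allows part of a
premise to be moved outside. -/
theorem Split.assoc {Γ Γ₁ Γ₂ Γ₃ Γ₄ : Ctx} (h : Split Γ Γ₁ Γ₂) (h₁ : Split Γ₁ Γ₃ Γ₄) :
    ∃ Γ', Split Γ Γ₃ Γ' ∧ Split Γ' Γ₄ Γ₂ := by
  induction h generalizing Γ₃ Γ₄ with
  | nil => cases h₁; exact ⟨[], .nil, .nil⟩
  | nonlin τ _ ih =>
    cases h₁ with | nonlin _ h => obtain ⟨Γ', ha, hb⟩ := ih h; exact ⟨_, .nonlin τ ha, .nonlin τ hb⟩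
  | left τ _ ih =>
    cases h₁ with
    | left _ h => obtain ⟨Γ', ha, hb⟩ := ih h; exact ⟨_, .left τ ha, .absent hb⟩
    | right _ h => obtain ⟨Γ', ha, hb⟩ := ih h; exact ⟨_, .right τ ha, .left τ hb⟩
  | right τ _ ih =>
    cases h₁ with | absent h => obtain ⟨Γ', ha, hb⟩ := ih h; exact ⟨_, .right τ ha, .right τ hb⟩
  | absent _ ih =>
    cases h₁ with | absent h => obtain ⟨Γ', ha, hb⟩ := ih h; exact ⟨_, .absent ha, .absent hb⟩

theorem Split.dropLin_left {Γ Γ₁ Γ₂ : Ctx} (h : Split Γ Γ₁ Γ₂) : Γ₁.dropLin = Γ.dropLin := by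
  induction h <;> simp_all [Ctx.dropLin, Decl.dropLin]

theorem Split.dropLin_right {Γ Γ₁ Γ₂ : Ctx} (h : Split Γ Γ₁ Γ₂) : Γ₂.dropLin = Γ.dropLin :=
  h.comm.dropLin_left

theorem Split.eq_of_noLin {Γ Γ₁ Γ₂ : Ctx} (h : Split Γ Γ₁ Γ₂) (hn : Γ₂.NoLin) : Γ₁ = Γ := by
  induction h with
  | nil => rfl
  | right τ _ _ => exact absurd (List.mem_cons_self ..) (hn τ)
  | _ => rename_i ih; rw [ih fun τ hτ => hn τ (List.mem_cons_of_mem _ hτ)]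

/-- Lets a rule that does not divide the linear context be treated as a splitting whose second half
has no linear variable. -/
theorem Split.self_dropLin (Γ : Ctx) : Split Γ Γ Γ.dropLin := by
  induction Γ with
  | nil => exact .nil
  | cons d Γ ih => cases d <;> constructor <;> exact ih

theorem Ctx.dropLin_noLin (Γ : Ctx) : Γ.dropLin.NoLin := by
  intro τ h
  obtain ⟨d, -, hd⟩ := List.mem_map.1 h
  cases d <;> simp [Decl.dropLin] at hd

theorem Ctx.NoLin.dropLin_eq {Γ : Ctx} (h : Γ.NoLin) : Γ.dropLin = Γ :=
  ((Split.self_dropLin Γ).comm).eq_of_noLin h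

theorem Ctx.dropLin_dropLin (Γ : Ctx) : Γ.dropLin.dropLin = Γ.dropLin :=
  (Ctx.dropLin_noLin Γ).dropLin_eq

theorem Ctx.NoLin.split {Γ : Ctx} (h : Γ.NoLin) : Split Γ Γ Γ := by
  have := Split.self_dropLin Γ
  rwa [h.dropLin_eq] at this

/-! ### Weakening -/

/-- `Ins Γ ρ Γ'`: the context `Γ'` is `Γ` with some non-linear or absent declarations inserted, and
`ρ` is the corresponding renaming. -/
inductive Ins : Ctx → (ℕ → ℕ) → Ctx → Prop
  | here {Γ : Ctx} (Θ : Ctx) : Θ.NoLin → Ins Γ (fun n => n + Θ.length) (Θ ++ Γ)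
  | cons {Γ Γ' : Ctx} {ρ : ℕ → ℕ} (d : Decl) : Ins Γ ρ Γ' → Ins (d :: Γ) (liftRen ρ) (d :: Γ')

theorem Ins.getElem? {Γ Γ' : Ctx} {ρ : ℕ → ℕ} (h : Ins Γ ρ Γ') (n : ℕ) : Γ'[ρ n]? = Γ[n]? := by
  induction h generalizing n with
  | here Θ _ => exact (List.getElem?_append_right (Nat.le_add_left _ _)).trans (by simp)
  | cons d _ ih => cases n <;> simp [liftRen, ih]

theorem Ins.lin {Γ Γ' : Ctx} {ρ : ℕ → ℕ} (h : Ins Γ ρ Γ') {m : ℕ} {σ : Ty}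
    (hm : Γ'[m]? = some (.lin σ)) : ∃ n, ρ n = m ∧ Γ[n]? = some (.lin σ) := by
  induction h generalizing m with
  | here Θ hΘ =>
    by_cases hlt : m < Θ.length
    · rw [List.getElem?_append_left hlt] at hm
      exact absurd (List.mem_of_getElem? hm) (hΘ σ)
    · rw [List.getElem?_append_right (not_lt.1 hlt)] at hm
      exact ⟨m - Θ.length, Nat.sub_add_cancel (not_lt.1 hlt), hm⟩
  | cons d _ ih =>
    cases m with
    | zero => exact ⟨0, rfl, by simpa using hm⟩
    | succ m =>
      obtain ⟨n, rfl, hn⟩ := ih (by simpa using hm)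
      exact ⟨n + 1, rfl, by simpa using hn⟩

theorem Ins.noLin {Γ Γ' : Ctx} {ρ : ℕ → ℕ} (h : Ins Γ ρ Γ') (hn : Γ.NoLin) : Γ'.NoLin := by
  intro τ hτ
  obtain ⟨m, hm⟩ := List.mem_iff_getElem?.1 hτ
  obtain ⟨n, -, hn'⟩ := h.lin hm
  exact hn τ (List.mem_of_getElem? hn')

theorem Ins.split {Γ Γ' Γ₁ Γ₂ : Ctx} {ρ : ℕ → ℕ} (h : Ins Γ ρ Γ') (hs : Split Γ Γ₁ Γ₂) :
    ∃ Γ₁' Γ₂', Split Γ' Γ₁' Γ₂' ∧ Ins Γ₁ ρ Γ₁' ∧ Ins Γ₂ ρ Γ₂' := by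
  induction h generalizing Γ₁ Γ₂ with
  | here Θ hΘ =>
    refine ⟨Θ ++ Γ₁, Θ ++ Γ₂, ?_, .here Θ hΘ, .here Θ hΘ⟩
    induction Θ with
    | nil => exact hs
    | cons d Θ ih =>
      have := ih fun τ hτ => hΘ τ (List.mem_cons_of_mem _ hτ)
      cases d with
      | lin τ => exact absurd (List.mem_cons_self ..) (hΘ τ)
      | _ => constructor; exact this
  | cons d _ ih =>
    cases hs <;> rename_i hs <;> obtain ⟨Γ₁', Γ₂', h0, h1, h2⟩ := ih hs <;>
      refine ⟨_, _, ?_, .cons _ h1, .cons _ h2⟩ <;> constructor <;> exact h0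

theorem Ins.dropLin {Γ Γ' : Ctx} {ρ : ℕ → ℕ} (h : Ins Γ ρ Γ') : Ins Γ.dropLin ρ Γ'.dropLin := by
  induction h with
  | @here Γ Θ hΘ =>
    rw [show (Θ ++ Γ : Ctx).dropLin = Θ ++ Γ.dropLin from
      List.map_append.trans (congrArg (· ++ Γ.dropLin) hΘ.dropLin_eq)]; exact .here Θ hΘ
  | cons d _ ih => exact .cons _ ih

/-- Inserted places carry no linear declaration, so every condition on the linear context survives.
The absent ones are needed as well: they stand for linear variables of an enclosing binder that are
consumed elsewhere. -/
theorem Typed.ren {Γ : Ctx} {t : Tm} {τ : Ty} (ht : Typed Γ t τ) {Γ' : Ctx} {ρ : ℕ → ℕ}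
    (h : Ins Γ ρ Γ') : Typed Γ' (t.ren ρ) τ := by
  induction ht generalizing Γ' ρ with
  | linVar hv =>
    refine .linVar ⟨(h.getElem? _).trans hv.1, fun m σ hm => ?_⟩
    obtain ⟨n, rfl, hn⟩ := h.lin hm
    rw [hv.2 n σ hn]
  | nonlinVar hv => exact .nonlinVar ⟨(h.getElem? _).trans hv.1, h.noLin hv.2⟩
  | lam _ ih => exact .lam (ih (h.cons _))
  | linApp hs _ _ iht ihu =>
    obtain ⟨_, _, h0, h1, h2⟩ := h.split hs
    exact .linApp h0 (iht h1) (ihu h2)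
  | lamBang _ ih => exact .lamBang (ih (h.cons _))
  | nonlinApp _ _ iht ihu => exact .nonlinApp (iht h) (ihu h.dropLin)
  | tens hs _ _ iht ihu =>
    obtain ⟨_, _, h0, h1, h2⟩ := h.split hs
    exact .tens h0 (iht h1) (ihu h2)
  | letTens hs _ _ iht ihu =>
    obtain ⟨_, _, h0, h1, h2⟩ := h.split hs
    exact .letTens h0 (iht h1) (ihu ((h2.cons _).cons _))
  | unit hn => exact .unit (h.noLin hn)
  | letUnit hs _ _ iht ihu =>
    obtain ⟨_, _, h0, h1, h2⟩ := h.split hs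
    exact .letUnit h0 (iht h1) (ihu h2)
  | pair _ _ iht ihu => exact .pair (iht h) (ihu h)
  | fst _ ih => exact .fst (ih h)
  | snd _ ih => exact .snd (ih h)
  | inl _ ih => exact .inl (ih h)
  | inr _ ih => exact .inr (ih h)
  | caseOf hs _ _ _ iht ihu ihv =>
    obtain ⟨_, _, h0, h1, h2⟩ := h.split hs
    exact .caseOf h0 (iht h1) (ihu (h2.cons _)) (ihv (h2.cons _))
  | triv => exact .triv
  | abort hs _ ih =>
    obtain ⟨_, _, h0, h1, -⟩ := h.split hs
    exact .abort h0 (ih h1)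

theorem Ins.succ {Γ : Ctx} {d : Decl} (hd : ∀ τ, d ≠ .lin τ) : Ins Γ Nat.succ (d :: Γ) :=
  Ins.here [d] fun τ hτ => hd τ (List.mem_singleton.1 hτ).symm

/-! ### Typed substitutions -/

/-- `SubTy Γ s Δ`: the substitution `s` sends the variables declared in `Γ` to terms typed in `Δ`,
the linear variables of `Δ` being distributed among the linear variables of `Γ`. -/
inductive SubTy : Ctx → (ℕ → Tm) → Ctx → Prop
  | nil {s : ℕ → Tm} {Δ : Ctx} : Δ.NoLin → SubTy [] s Δ
  | nonlin {Γ Δ : Ctx} {s : ℕ → Tm} {τ : Ty} :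
      Typed Δ.dropLin (s 0) τ → SubTy Γ (fun n => s (n + 1)) Δ → SubTy (.nonlin τ :: Γ) s Δ
  | lin {Γ Δ Δ₁ Δ₂ : Ctx} {s : ℕ → Tm} {τ : Ty} : Split Δ Δ₁ Δ₂ →
      Typed Δ₁ (s 0) τ → SubTy Γ (fun n => s (n + 1)) Δ₂ → SubTy (.lin τ :: Γ) s Δ
  | absent {Γ Δ : Ctx} {s : ℕ → Tm} :
      SubTy Γ (fun n => s (n + 1)) Δ → SubTy (.absent :: Γ) s Δ

theorem SubTy.noLin {Γ Δ : Ctx} {s : ℕ → Tm} (h : SubTy Γ s Δ) (hn : Γ.NoLin) : Δ.NoLin := by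
  induction h with
  | nil h => exact h
  | lin => exact absurd (List.mem_cons_self ..) (hn _)
  | _ => rename_i ih; exact ih fun τ hτ => hn τ (List.mem_cons_of_mem _ hτ)

theorem SubTy.nonlinVar {Γ Δ : Ctx} {s : ℕ → Tm} (h : SubTy Γ s Δ) {n : ℕ} {τ : Ty}
    (hn : Γ[n]? = some (.nonlin τ)) : Typed Δ.dropLin (s n) τ := by
  induction h generalizing n with
  | nil => simp at hn
  | nonlin h0 _ ih =>
    cases n with
    | zero => obtain rfl : _ = τ := by simpa using hn
              exact h0
    | succ n => exact ih (by simpa using hn)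
  | lin hs _ _ ih =>
    cases n with
    | zero => simp at hn
    | succ n => rw [← hs.dropLin_right]; exact ih (by simpa using hn)
  | absent _ ih =>
    cases n with
    | zero => simp at hn
    | succ n => exact ih (by simpa using hn)

theorem Ctx.IsLinVar.tail {Γ : Ctx} {d : Decl} {n : ℕ} {τ : Ty}
    (h : Ctx.IsLinVar (d :: Γ) (n + 1) τ) : Γ.IsLinVar n τ :=
  ⟨by simpa using h.1, fun m σ hm => by simpa using h.2 (m + 1) σ (by simpa using hm)⟩

theorem SubTy.linVar {Γ Δ : Ctx} {s : ℕ → Tm} (h : SubTy Γ s Δ) {n : ℕ} {τ : Ty}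
    (hn : Γ.IsLinVar n τ) : Typed Δ (s n) τ := by
  induction h generalizing n with
  | nil => simp [Ctx.IsLinVar] at hn
  | nonlin h0 _ ih =>
    cases n with
    | zero => simp [Ctx.IsLinVar] at hn
    | succ n => exact ih hn.tail
  | lin hs h0 h1 ih =>
    cases n with
    | zero =>
      obtain rfl : _ = τ := by simpa using hn.1
      -- The variable 0 is the only linear one of the source, so the remaining substitution consumes
      -- nothing and `Δ₁` is all of `Δ`.
      rw [← hs.eq_of_noLin (h1.noLin fun σ hσ => ?_)]
      · exact h0
      · obtain ⟨m, hm⟩ := List.mem_iff_getElem?.1 hσ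
        simpa using hn.2 (m + 1) σ (by simpa using hm)
    | succ n => simpa using hn.2 0 _ rfl
  | absent _ ih =>
    cases n with
    | zero => simp [Ctx.IsLinVar] at hn
    | succ n => exact ih hn.tail

/-- Each linear variable carries its own share of `Δ`; that share follows the variable to the half
of `Γ` it is sent to, and the shares are regrouped by associativity and commutativity. Non-linear
variables use no linear resource and go to both halves. -/
theorem SubTy.split {Γ Δ Γ₁ Γ₂ : Ctx} {s : ℕ → Tm} (h : SubTy Γ s Δ) (hs : Split Γ Γ₁ Γ₂) :
    ∃ Δ₁ Δ₂, Split Δ Δ₁ Δ₂ ∧ SubTy Γ₁ s Δ₁ ∧ SubTy Γ₂ s Δ₂ := by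
  induction h generalizing Γ₁ Γ₂ with
  | nil hn => cases hs; exact ⟨_, _, hn.split, .nil hn, .nil hn⟩
  | nonlin h0 _ ih =>
    cases hs with
    | nonlin _ hs =>
      obtain ⟨Δ₁, Δ₂, hd, h1, h2⟩ := ih hs
      exact ⟨Δ₁, Δ₂, hd, .nonlin (hd.dropLin_left ▸ h0) h1, .nonlin (hd.dropLin_right ▸ h0) h2⟩
  | lin hΔ h0 _ ih =>
    cases hs with
    | left _ hs =>
      obtain ⟨Δ₁, Δ₂, hd, h1, h2⟩ := ih hs
      obtain ⟨Δ', ha, hb⟩ := hΔ.comm.assoc hd.comm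
      exact ⟨Δ', Δ₂, ha.comm, .lin hb.comm h0 h1, .absent h2⟩
    | right _ hs =>
      obtain ⟨Δ₁, Δ₂, hd, h1, h2⟩ := ih hs
      obtain ⟨Δ', ha, hb⟩ := hΔ.comm.assoc hd
      exact ⟨Δ₁, Δ', ha, .absent h1, .lin hb.comm h0 h2⟩
  | absent _ ih =>
    cases hs with
    | absent hs =>
      obtain ⟨Δ₁, Δ₂, hd, h1, h2⟩ := ih hs
      exact ⟨Δ₁, Δ₂, hd, .absent h1, .absent h2⟩

theorem SubTy.dropLin {Γ Δ : Ctx} {s : ℕ → Tm} (h : SubTy Γ s Δ) :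
    SubTy Γ.dropLin s Δ.dropLin := by
  induction h with
  | nil hn => exact .nil (Ctx.dropLin_noLin _)
  | nonlin h0 _ ih => exact .nonlin (by rwa [Ctx.dropLin_dropLin]) ih
  | lin hs _ _ ih => exact .absent (hs.dropLin_right ▸ ih)
  | absent _ ih => exact .absent ih

theorem SubTy.weaken {Γ Δ : Ctx} {s : ℕ → Tm} (h : SubTy Γ s Δ) {d : Decl}
    (hd : ∀ τ, d ≠ .lin τ) : SubTy Γ (fun n => (s n).ren Nat.succ) (d :: Δ) := by
  have hd' : d.dropLin = d := by cases d <;> simp_all [Decl.dropLin]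
  induction h with
  | nil hn => exact .nil ((Ins.succ hd).noLin hn)
  | @nonlin Γ Δ s τ h0 _ ih =>
    refine .nonlin ?_ ih
    have := h0.ren (Ins.succ hd)
    simpa only [Ctx.dropLin, List.map_cons, hd'] using this
  | lin hs h0 _ ih =>
    refine .lin ?_ (h0.ren (Ins.succ hd)) ih
    cases d with
    | lin τ => exact absurd rfl (hd τ)
    | _ => constructor; exact hs
  | absent _ ih => exact .absent ih

theorem Ctx.isLinVar_zero (Γ : Ctx) (τ : Ty) : Ctx.IsLinVar (.lin τ :: Γ.dropLin) 0 τ := by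
  refine ⟨rfl, fun m σ hm => ?_⟩
  cases m with
  | zero => rfl
  | succ m => exact absurd (List.mem_of_getElem? (by simpa using hm)) (Γ.dropLin_noLin σ)

theorem SubTy.lift {Γ Δ : Ctx} {s : ℕ → Tm} (h : SubTy Γ s Δ) (d : Decl) :
    SubTy (d :: Γ) (liftSub s) (d :: Δ) := by
  cases d with
  | nonlin τ =>
    refine .nonlin (.nonlinVar ⟨rfl, Ctx.dropLin_noLin _⟩) (h.weaken (by simp))
  | lin τ =>
    -- The new variable alone is spent on the place 0; the other terms keep all of `Δ`, with that
    -- place absent.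
    exact .lin (.left τ (Split.self_dropLin Δ).comm) (.linVar (Δ.isLinVar_zero τ))
      (h.weaken (by simp))
  | absent => exact .absent (h.weaken (by simp))

theorem SubTy.id (Γ : Ctx) : SubTy Γ Tm.var Γ := by
  induction Γ with
  | nil => exact .nil (by simp [Ctx.NoLin])
  | cons d Γ ih => have := ih.lift d; rwa [liftSub_var] at this

theorem Typed.sub {Γ : Ctx} {t : Tm} {τ : Ty} (ht : Typed Γ t τ) {Δ : Ctx} {s : ℕ → Tm}
    (h : SubTy Γ s Δ) : Typed Δ (t.sub s) τ := by
  induction ht generalizing Δ s with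
  | linVar hv => exact h.linVar hv
  | nonlinVar hv =>
    have := h.nonlinVar hv.1
    rwa [(h.noLin hv.2).dropLin_eq] at this
  | lam _ ih => exact .lam (ih (h.lift _))
  | linApp hs _ _ iht ihu =>
    obtain ⟨_, _, h0, h1, h2⟩ := h.split hs
    exact .linApp h0 (iht h1) (ihu h2)
  | lamBang _ ih => exact .lamBang (ih (h.lift _))
  | nonlinApp _ _ iht ihu => exact .nonlinApp (iht h) (ihu h.dropLin)
  | tens hs _ _ iht ihu =>
    obtain ⟨_, _, h0, h1, h2⟩ := h.split hs
    exact .tens h0 (iht h1) (ihu h2)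
  | letTens hs _ _ iht ihu =>
    obtain ⟨_, _, h0, h1, h2⟩ := h.split hs
    exact .letTens h0 (iht h1) (ihu ((h2.lift _).lift _))
  | unit hn => exact .unit (h.noLin hn)
  | letUnit hs _ _ iht ihu =>
    obtain ⟨_, _, h0, h1, h2⟩ := h.split hs
    exact .letUnit h0 (iht h1) (ihu h2)
  | pair _ _ iht ihu => exact .pair (iht h) (ihu h)
  | fst _ ih => exact .fst (ih h)
  | snd _ ih => exact .snd (ih h)
  | inl _ ih => exact .inl (ih h)
  | inr _ ih => exact .inr (ih h)
  | caseOf hs _ _ _ iht ihu ihv =>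
    obtain ⟨_, _, h0, h1, h2⟩ := h.split hs
    exact .caseOf h0 (iht h1) (ihu (h2.lift _)) (ihv (h2.lift _))
  | triv => exact .triv
  | abort hs _ ih =>
    obtain ⟨_, _, h0, h1, -⟩ := h.split hs
    exact .abort h0 (ih h1)

theorem Typed.inst_lin {Γ Γ₁ Γ₂ : Ctx} {t u : Tm} {τ σ : Ty} (hs : Split Γ Γ₁ Γ₂)
    (ht : Typed (.lin τ :: Γ₁) t σ) (hu : Typed Γ₂ u τ) : Typed Γ (t.inst u) σ :=
  ht.sub (.lin hs.comm hu (SubTy.id Γ₁))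

theorem Typed.inst_nonlin {Γ : Ctx} {t u : Tm} {τ σ : Ty}
    (ht : Typed (.nonlin τ :: Γ) t σ) (hu : Typed Γ.dropLin u τ) : Typed Γ (t.inst u) σ :=
  ht.sub (.nonlin hu (SubTy.id Γ))

/-! ### Subject reduction -/

theorem Typed.beta {Γ : Ctx} {t t' : Tm} {τ : Ty} (ht : Typed Γ t τ) (h : BetaRule t t') :
    Typed Γ t' τ := by
  cases h with
  | lam t u =>
    cases ht with
    | linApp hs h1 h2 => cases h1 with | lam h1 => exact h1.inst_lin hs h2
    | nonlinApp h1 h2 => cases h1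
  | lamBang t u =>
    cases ht with
    | linApp hs h1 h2 => cases h1
    | nonlinApp h1 h2 => cases h1 with | lamBang h1 => exact h1.inst_nonlin h2
  | fst t u => cases ht with | fst h => cases h with | pair h1 h2 => exact h1
  | snd t u => cases ht with | snd h => cases h with | pair h1 h2 => exact h2
  | inl t u v =>
    cases ht with | caseOf hs h1 h2 h3 => cases h1 with | inl h1 => exact h2.inst_lin hs.comm h1
  | inr t u v =>
    cases ht with | caseOf hs h1 h2 h3 => cases h1 with | inr h1 => exact h3.inst_lin hs.comm h1
  | letTens t u v =>
    cases ht with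
    | letTens hs h1 h2 =>
      cases h1 with
      | tens hs' ha hb =>
        -- The share of the second component is split off first, because its variable `y` has index
        -- 0.
        obtain ⟨Γ', h3, h4⟩ := hs.assoc hs'.comm
        exact h2.sub (.lin h3 hb (.lin h4 ha (SubTy.id _)))
  | letUnit t =>
    cases ht with
    | letUnit hs h1 h2 => cases h1 with | unit hn => rwa [← hs.comm.eq_of_noLin hn]

theorem Split.of_noLin {Γ Γ₁ Γ₂ : Ctx} (h : Split Γ Γ₁ Γ₂) (hn : Γ₂.NoLin) :
    Γ₁ = Γ ∧ Γ₂ = Γ.dropLin :=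
  ⟨h.eq_of_noLin hn, hn.dropLin_eq.symm.trans h.dropLin_right⟩

/-- Inversion of the typing of `E[t]`: the hole may be filled with another term, after a weakening
of the context of the frame. -/
theorem Typed.plug_inv {Γ : Ctx} {F : Frame} {t : Tm} {κ : Ty} (h : Typed Γ (F.plug t) κ) :
    ∃ Γ₁ Γ₂ τ, Split Γ Γ₁ Γ₂ ∧ Typed Γ₁ t τ ∧
      ∀ (Γ' Γ₁' Γ₂' : Ctx) (ρ : ℕ → ℕ) (t' : Tm), Ins Γ₂ ρ Γ₂' → Split Γ' Γ₁' Γ₂' →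
        Typed Γ₁' t' τ → Typed Γ' ((F.ren ρ).plug t') κ := by
  cases F with
  | app w =>
    cases h with
    | linApp hs h1 h2 =>
      exact ⟨_, _, _, hs, h1, fun _ _ _ ρ t' hi hs' h' => .linApp hs' h' (h2.ren hi)⟩
    | nonlinApp h1 h2 =>
      refine ⟨_, _, _, Split.self_dropLin Γ, h1, fun _ _ _ ρ t' hi hs' h' => ?_⟩
      -- The frame consumes no linear variable, even after weakening, so the hole receives the whole
      -- context.
      obtain ⟨rfl, rfl⟩ := hs'.of_noLin (hi.noLin Γ.dropLin_noLin)
      exact .nonlinApp h' (h2.ren hi)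
  | proj i =>
    cases h with
    | fst h1 =>
      refine ⟨_, _, _, Split.self_dropLin Γ, h1, fun _ _ _ ρ t' hi hs' h' => ?_⟩
      obtain ⟨rfl, rfl⟩ := hs'.of_noLin (hi.noLin Γ.dropLin_noLin)
      exact .fst h'
    | snd h1 =>
      refine ⟨_, _, _, Split.self_dropLin Γ, h1, fun _ _ _ ρ t' hi hs' h' => ?_⟩
      obtain ⟨rfl, rfl⟩ := hs'.of_noLin (hi.noLin Γ.dropLin_noLin)
      exact .snd h'
  | letIn p w =>
    cases h with
    | letTens hs h1 h2 =>
      exact ⟨_, _, _, hs, h1, fun _ _ _ ρ t' hi hs' h' =>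
        .letTens hs' h' (h2.ren ((hi.cons _).cons _))⟩
    | letUnit hs h1 h2 =>
      exact ⟨_, _, _, hs, h1, fun _ _ _ ρ t' hi hs' h' => .letUnit hs' h' (h2.ren hi)⟩
  | abort =>
    cases h with
    | abort hs h1 => exact ⟨_, _, _, hs, h1, fun _ _ _ ρ t' hi hs' h' => .abort hs' h'⟩
  | caseOf v w =>
    cases h with
    | caseOf hs h1 h2 h3 =>
      exact ⟨_, _, _, hs, h1, fun _ _ _ ρ t' hi hs' h' =>
        .caseOf hs' h' (h2.ren (hi.cons _)) (h3.ren (hi.cons _))⟩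

/-- By associativity the extruded scrutinee gets its own share of the context, and the remainder is
divided between the continuation and the frame. The linear variables bound by the extruded
construction go to the hole, hence are absent in the context of the frame. -/
theorem Typed.extr {Γ : Ctx} {t t' : Tm} {τ : Ty} (ht : Typed Γ t τ) (h : ExtrRule t t') :
    Typed Γ t' τ := by
  have h0 (Γ : Ctx) : Ins Γ (fun n => n + 0) Γ := .here [] (by simp [Ctx.NoLin])
  have h1 (Γ : Ctx) : Ins Γ (fun n => n + 1) (.absent :: Γ) :=
    .here [.absent] (by simp [Ctx.NoLin])
  have h2 (Γ : Ctx) : Ins Γ (fun n => n + 2) (.absent :: .absent :: Γ) :=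
    .here [.absent, .absent] (by simp [Ctx.NoLin])
  cases h.frameExtr with
  | letIn F p t u =>
    obtain ⟨Γ₁, Γ₂, σ, hs, hl, hF⟩ := ht.plug_inv
    cases hl with
    | letTens hs' ha hb =>
      obtain ⟨Γ', h3, h4⟩ := hs.assoc hs'
      exact .letTens h3 ha (hF _ _ _ _ _ (h2 _) (.left _ (.left _ h4)) hb)
    | letUnit hs' ha hb =>
      obtain ⟨Γ', h3, h4⟩ := hs.assoc hs'
      exact .letUnit h3 ha (hF _ _ _ _ _ (h0 _) h4 hb)
  | abort F t =>
    obtain ⟨Γ₁, Γ₂, σ, hs, hl, -⟩ := ht.plug_inv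
    cases hl with
    | abort hs' ha =>
      obtain ⟨Γ', h3, -⟩ := hs.assoc hs'
      -- The linear variables of the erased frame are absorbed by the spare context that the `abort`
      -- rule allows.
      exact .abort h3 ha
  | caseOf F t u v =>
    obtain ⟨Γ₁, Γ₂, σ, hs, hl, hF⟩ := ht.plug_inv
    cases hl with
    | caseOf hs' ha hb hc =>
      obtain ⟨Γ', h3, h4⟩ := hs.assoc hs'
      exact .caseOf h3 ha (hF _ _ _ _ _ (h1 _) (.left _ h4) hb)
        (hF _ _ _ _ _ (h1 _) (.left _ h4) hc)

theorem Typed.congClosure {R : Tm → Tm → Prop}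
    (hR : ∀ (Γ : Ctx) (t t' : Tm) (τ : Ty), R t t' → Typed Γ t τ → Typed Γ t' τ) {t t' : Tm}
    (h : CongClosure R t t') {Γ : Ctx} {τ : Ty} (ht : Typed Γ t τ) : Typed Γ t' τ := by
  induction h generalizing Γ τ with
  | rule hr => exact hR _ _ _ _ hr ht
  | lam _ ih => cases ht with | lam h => exact .lam (ih h)
  | lamBang _ ih => cases ht with | lamBang h => exact .lamBang (ih h)
  | appL _ _ ih =>
    cases ht with
    | linApp hs h1 h2 => exact .linApp hs (ih h1) h2
    | nonlinApp h1 h2 => exact .nonlinApp (ih h1) h2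
  | appR _ _ ih =>
    cases ht with
    | linApp hs h1 h2 => exact .linApp hs h1 (ih h2)
    | nonlinApp h1 h2 => exact .nonlinApp h1 (ih h2)
  | tensL _ _ ih => cases ht with | tens hs h1 h2 => exact .tens hs (ih h1) h2
  | tensR _ _ ih => cases ht with | tens hs h1 h2 => exact .tens hs h1 (ih h2)
  | letL _ _ _ ih =>
    cases ht with
    | letTens hs h1 h2 => exact .letTens hs (ih h1) h2
    | letUnit hs h1 h2 => exact .letUnit hs (ih h1) h2
  | letR _ _ _ ih =>
    cases ht with
    | letTens hs h1 h2 => exact .letTens hs h1 (ih h2)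
    | letUnit hs h1 h2 => exact .letUnit hs h1 (ih h2)
  | pairL _ _ ih => cases ht with | pair h1 h2 => exact .pair (ih h1) h2
  | pairR _ _ ih => cases ht with | pair h1 h2 => exact .pair h1 (ih h2)
  | proj _ _ ih =>
    cases ht with
    | fst h => exact .fst (ih h)
    | snd h => exact .snd (ih h)
  | inj _ _ ih =>
    cases ht with
    | inl h => exact .inl (ih h)
    | inr h => exact .inr (ih h)
  | case₁ _ _ _ ih => cases ht with | caseOf hs h1 h2 h3 => exact .caseOf hs (ih h1) h2 h3
  | case₂ _ _ _ ih => cases ht with | caseOf hs h1 h2 h3 => exact .caseOf hs h1 (ih h2) h3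
  | case₃ _ _ _ ih => cases ht with | caseOf hs h1 h2 h3 => exact .caseOf hs h1 h2 (ih h3)
  | abort _ ih => cases ht with | abort hs h => exact .abort hs (ih h)

theorem Typed.reduces {Γ : Ctx} {t t' : Tm} {τ : Ty} (ht : Typed Γ t τ)
    (h : Relation.ReflTransGen (CongClosure Rule) t t') : Reduces Γ τ t t' ∧ Typed Γ t' τ := by
  induction h with
  | refl => exact ⟨.refl, ht⟩
  | tail _ hs ih =>
    have h' := ih.2.congClosure (fun _ _ _ _ hr hT => hr.elim hT.beta hT.extr) hs
    exact ⟨ih.1.tail ⟨ih.2, h', hs.of_or⟩, h'⟩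

/-! ### Reducibility -/

/-- Terms which reduce to a tree of `let` and `case` over neutral terms, with leaves that are
neutral or satisfy `P`. -/
inductive Cl (P : Tm → Prop) : Tm → Prop
  | ne {t : Tm} : Shape .ne t → Cl P t
  | val {t : Tm} : P t → Cl P t
  | letIn {t u : Tm} (p : Pat) : Shape .ne t → Cl P u → Cl P (.letIn p t u)
  | caseOf {t u v : Tm} : Shape .ne t → Cl P u → Cl P v → Cl P (.caseOf t u v)
  | expand {t t' : Tm} : CongClosure Rule t t' → Cl P t' → Cl P t

theorem Cl.ren {P : Tm → Prop} (hP : ∀ v (ρ : ℕ → ℕ), P v → P (v.ren ρ)) {t : Tm} (h : Cl P t)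
    (ρ : ℕ → ℕ) : Cl P (t.ren ρ) := by
  induction h generalizing ρ with
  | ne h => exact .ne (h.ren ρ)
  | val h => exact .val (hP _ _ h)
  | letIn p h _ ih => exact .letIn p (h.ren ρ) (ih _)
  | caseOf h _ _ ihu ihv => exact .caseOf (h.ren ρ) (ihu _) (ihv _)
  | expand hs _ ih => exact .expand (hs.ren (fun _ _ ρ hr => Rule.ren hr ρ) ρ) (ih ρ)

theorem Cl.beta {P : Tm → Prop} {t t' : Tm} (h : BetaRule t t') (ht : Cl P t') : Cl P t :=
  .expand (.rule (.inl h)) ht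

theorem Cl.extr {P : Tm → Prop} {t t' : Tm} (h : FrameExtr t t') (ht : Cl P t') : Cl P t :=
  .expand (.rule (.inr h.extrRule)) ht

/-- To show that `E[t]` is reducible it is enough to consider neutral terms and values `t`, in all
renamings of `E`. -/
theorem Cl.plug {P Q : Tm → Prop} {t : Tm} (h : Cl P t) (F : Frame)
    (hne : ∀ (ρ : ℕ → ℕ) (n : Tm), Shape .ne n → Cl Q ((F.ren ρ).plug n))
    (hval : ∀ (ρ : ℕ → ℕ) (v : Tm), P v → Cl Q ((F.ren ρ).plug v)) : Cl Q (F.plug t) := by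
  induction h generalizing F with
  | ne h => exact F.ren_id ▸ hne id _ h
  | val h => exact F.ren_id ▸ hval id _ h
  | letIn p h _ ih =>
    -- After extrusion the frame is shifted under the pattern; the hypotheses hold for all renamings
    -- of `F`, so they apply to the shifted frame.
    refine .extr (.letIn F p _ _) (.letIn p h (ih _ (fun ρ n hn => ?_) fun ρ v hv => ?_))
    · rw [F.ren_ren]; exact hne _ n hn
    · rw [F.ren_ren]; exact hval _ v hv
  | caseOf h _ _ ihu ihv =>
    refine .extr (.caseOf F _ _ _) (.caseOf h (ihu _ (fun ρ n hn => ?_) fun ρ v hv => ?_)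
      (ihv _ (fun ρ n hn => ?_) fun ρ v hv => ?_))
    · rw [F.ren_ren]; exact hne _ n hn
    · rw [F.ren_ren]; exact hval _ v hv
    · rw [F.ren_ren]; exact hne _ n hn
    · rw [F.ren_ren]; exact hval _ v hv
  | expand hs _ ih => exact .expand (hs.plug F) (ih F hne hval)

/-- The body `a` of an abstraction sends the terms in `P` to terms in `Q`, in all renamings. -/
def Maps (P Q : Tm → Prop) (a : Tm) : Prop :=
  ∀ (ρ : ℕ → ℕ) (u : Tm), P u → Q (a.sub (consSub u (fun n => .var (ρ n))))

/-- The reducible values of a type. -/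
def Val : Ty → Tm → Prop
  | .base, _ => False
  | .lolli τ σ, v => ∃ a, v = .lam a ∧ Maps (Cl (Val τ)) (Cl (Val σ)) a
  | .tensor τ σ, v => ∃ a b, v = .tens a b ∧ Cl (Val τ) a ∧ Cl (Val σ) b
  | .one, v => v = .unit
  | .arrow τ σ, v => ∃ a, v = .lamBang a ∧ Maps (Cl (Val τ)) (Cl (Val σ)) a
  | .amp τ σ, v => ∃ a b, v = .pair a b ∧ Cl (Val τ) a ∧ Cl (Val σ) b
  | .plus τ σ, v => (∃ a, v = .inj .fst a ∧ Cl (Val τ) a) ∨ ∃ a, v = .inj .snd a ∧ Cl (Val σ) a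
  | .top, v => v = .triv
  | .zero, _ => False

/-- The reducible terms of a type. -/
abbrev Red (τ : Ty) : Tm → Prop := Cl (Val τ)

theorem Maps.ren {P Q : Tm → Prop} {a : Tm} (h : Maps P Q a) (ρ : ℕ → ℕ) :
    Maps P Q (a.ren (liftRen ρ)) := by
  intro ρ' u hu
  rw [Tm.sub_ren]
  convert h (ρ' ∘ ρ) u hu using 2
  funext n; cases n <;> rfl

theorem Val.ren {τ : Ty} {v : Tm} (h : Val τ v) (ρ : ℕ → ℕ) : Val τ (v.ren ρ) := by
  induction τ generalizing v ρ with
  | base => exact h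
  | lolli τ σ _ _ => obtain ⟨a, rfl, h⟩ := h; exact ⟨_, rfl, h.ren ρ⟩
  | tensor τ σ ih₁ ih₂ =>
    obtain ⟨a, b, rfl, ha, hb⟩ := h
    exact ⟨_, _, rfl, ha.ren (fun _ ρ h => ih₁ h ρ) ρ, hb.ren (fun _ ρ h => ih₂ h ρ) ρ⟩
  | one => obtain rfl : v = _ := h; rfl
  | arrow τ σ _ _ => obtain ⟨a, rfl, h⟩ := h; exact ⟨_, rfl, h.ren ρ⟩
  | amp τ σ ih₁ ih₂ =>
    obtain ⟨a, b, rfl, ha, hb⟩ := h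
    exact ⟨_, _, rfl, ha.ren (fun _ ρ h => ih₁ h ρ) ρ, hb.ren (fun _ ρ h => ih₂ h ρ) ρ⟩
  | plus τ σ ih₁ ih₂ =>
    rcases h with ⟨a, rfl, ha⟩ | ⟨a, rfl, ha⟩
    · exact .inl ⟨_, rfl, ha.ren (fun _ ρ h => ih₁ h ρ) ρ⟩
    · exact .inr ⟨_, rfl, ha.ren (fun _ ρ h => ih₂ h ρ) ρ⟩
  | top => obtain rfl : v = _ := h; rfl
  | zero => exact h

theorem Red.ren {τ : Ty} {t : Tm} (h : Red τ t) (ρ : ℕ → ℕ) : Red τ (t.ren ρ) :=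
  Cl.ren (P := Val τ) (fun _ ρ h => h.ren ρ) h ρ

/-! ### Reducible terms are weakly normalizing -/

/-- `t` reduces to a term with the shape of a normal term. -/
def WN (t : Tm) : Prop := ∃ t', Relation.ReflTransGen (CongClosure Rule) t t' ∧ Shape .nf t'

theorem WN.map {f : Tm → Tm} (hf : ∀ t t', CongClosure Rule t t' → CongClosure Rule (f t) (f t'))
    (hs : ∀ t, Shape .nf t → Shape .nf (f t)) {t : Tm} (h : WN t) : WN (f t) := by
  obtain ⟨t', hr, ht'⟩ := h
  exact ⟨f t', hr.lift f hf, hs _ ht'⟩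

theorem WN.map₂ {f : Tm → Tm → Tm}
    (hl : ∀ t t' u, CongClosure Rule t t' → CongClosure Rule (f t u) (f t' u))
    (hr : ∀ t u u', CongClosure Rule u u' → CongClosure Rule (f t u) (f t u'))
    (hs : ∀ t u, Shape .nf t → Shape .nf u → Shape .nf (f t u)) {t u : Tm} (ht : WN t)
    (hu : WN u) : WN (f t u) := by
  obtain ⟨t', ht, hst⟩ := ht
  obtain ⟨u', hu, hsu⟩ := hu
  exact ⟨f t' u', (ht.lift (f · u) fun _ _ => hl _ _ u).trans (hu.lift (f t') (hr t')),
    hs _ _ hst hsu⟩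

/-- A `let` or `case` over a neutral scrutinee is normal as soon as its branches are, so it suffices
to normalize the leaves of the tree. -/
theorem Cl.wn {P : Tm → Prop} (hP : ∀ v, P v → WN v) {t : Tm} (h : Cl P t) : WN t := by
  induction h with
  | ne h => exact ⟨_, .refl, .ofNe h⟩
  | val h => exact hP _ h
  | letIn p h _ ih => exact ih.map (fun _ _ => .letR p _) fun _ => .letIn h
  | caseOf h _ _ ihu ihv =>
    exact WN.map₂ (f := .caseOf _) (fun _ _ v => .case₂ _ v) (fun u _ _ => .case₃ _ u)
      (fun _ _ => .caseOf h) ihu ihv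
  | expand hs _ ih =>
    obtain ⟨t', hr, ht'⟩ := ih
    exact ⟨t', hr.head hs, ht'⟩

/-- With the renaming `Nat.succ` and the argument `var 0`, the tested instance of the body is the
body itself. -/
theorem Maps.wn {P Q : Tm → Prop} (hP : P (.var 0)) (hQ : ∀ t, Q t → WN t) {a : Tm}
    (h : Maps P Q a) : WN a := by
  have h' := hQ _ (h Nat.succ (.var 0) hP)
  rwa [show consSub (.var 0) (fun n => Tm.var (Nat.succ n)) = Tm.var by
    funext n; cases n <;> rfl, Tm.sub_var] at h'

theorem Val.wn {τ : Ty} {v : Tm} (h : Val τ v) : WN v := by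
  induction τ generalizing v with
  | base => exact h.elim
  | lolli τ σ _ ih =>
    obtain ⟨a, rfl, h⟩ := h
    exact (h.wn (.ne (.var 0)) fun _ => Cl.wn fun _ => ih).map (fun _ _ => .lam) fun _ => .lam
  | tensor τ σ ih₁ ih₂ =>
    obtain ⟨a, b, rfl, ha, hb⟩ := h
    exact WN.map₂ (fun _ _ u => .tensL u) (fun t _ _ => .tensR t) (fun _ _ => .tens)
      (ha.wn fun _ => ih₁) (hb.wn fun _ => ih₂)
  | one => obtain rfl : v = _ := h; exact ⟨_, .refl, .unit⟩
  | arrow τ σ _ ih =>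
    obtain ⟨a, rfl, h⟩ := h
    exact (h.wn (.ne (.var 0)) fun _ => Cl.wn fun _ => ih).map (fun _ _ => .lamBang)
      fun _ => .lamBang
  | amp τ σ ih₁ ih₂ =>
    obtain ⟨a, b, rfl, ha, hb⟩ := h
    exact WN.map₂ (fun _ _ u => .pairL u) (fun t _ _ => .pairR t) (fun _ _ => .pair)
      (ha.wn fun _ => ih₁) (hb.wn fun _ => ih₂)
  | plus τ σ ih₁ ih₂ =>
    rcases h with ⟨a, rfl, ha⟩ | ⟨a, rfl, ha⟩
    · exact (ha.wn fun _ => ih₁).map (fun _ _ => .inj .fst) fun _ => .inj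
    · exact (ha.wn fun _ => ih₂).map (fun _ _ => .inj .snd) fun _ => .inj
  | top => obtain rfl : v = _ := h; exact ⟨_, .refl, .triv⟩
  | zero => exact h.elim

theorem Red.wn {τ : Ty} {t : Tm} (h : Red τ t) : WN t := Cl.wn (fun _ => Val.wn) h

/-! ### The fundamental lemma -/

/-- The variable `n` is declared with type `τ`, in the linear or in the non-linear context. -/
def Ctx.Has (Γ : Ctx) (n : ℕ) (τ : Ty) : Prop :=
  Γ[n]? = some (.lin τ) ∨ Γ[n]? = some (.nonlin τ)

theorem Split.has_left {Γ Γ₁ Γ₂ : Ctx} (h : Split Γ Γ₁ Γ₂) {n : ℕ} {τ : Ty} (hn : Γ₁.Has n τ) :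
    Γ.Has n τ := by
  induction h generalizing n with
  | nil => exact hn
  | _ => rename_i ih; cases n <;> simp_all [Ctx.Has]

/-- `s` sends the variables declared in `Γ` to reducible terms. -/
def RedSub (Γ : Ctx) (s : ℕ → Tm) : Prop := ∀ n τ, Γ.Has n τ → Red τ (s n)

theorem RedSub.left {Γ Γ₁ Γ₂ : Ctx} {s : ℕ → Tm} (h : RedSub Γ s) (hs : Split Γ Γ₁ Γ₂) :
    RedSub Γ₁ s := fun n τ hn => h n τ (hs.has_left hn)

theorem RedSub.right {Γ Γ₁ Γ₂ : Ctx} {s : ℕ → Tm} (h : RedSub Γ s) (hs : Split Γ Γ₁ Γ₂) :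
    RedSub Γ₂ s := h.left hs.comm

theorem RedSub.ren {Γ : Ctx} {s : ℕ → Tm} (h : RedSub Γ s) (ρ : ℕ → ℕ) :
    RedSub Γ (fun n => (s n).ren ρ) := fun n τ hn => (h n τ hn).ren ρ

theorem RedSub.cons_lin {Γ : Ctx} {s : ℕ → Tm} (h : RedSub Γ s) {u : Tm} {τ : Ty}
    (hu : Red τ u) : RedSub (.lin τ :: Γ) (consSub u s) := by
  rintro (_ | n) σ hn
  · obtain rfl : τ = σ := by simpa [Ctx.Has] using hn
    exact hu
  · exact h n σ (by simpa [Ctx.Has] using hn)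

theorem RedSub.cons_nonlin {Γ : Ctx} {s : ℕ → Tm} (h : RedSub Γ s) {u : Tm} {τ : Ty}
    (hu : Red τ u) : RedSub (.nonlin τ :: Γ) (consSub u s) := by
  rintro (_ | n) σ hn
  · obtain rfl : τ = σ := by simpa [Ctx.Has] using hn
    exact hu
  · exact h n σ (by simpa [Ctx.Has] using hn)

theorem RedSub.lift_lin {Γ : Ctx} {s : ℕ → Tm} (h : RedSub Γ s) (τ : Ty) :
    RedSub (.lin τ :: Γ) (liftSub s) := by
  have h' := (h.ren Nat.succ).cons_lin (τ := τ) (.ne (.var 0))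
  rintro (_ | n) σ hn <;> exact h' _ σ hn

theorem Tm.sub_lift_cons (t u : Tm) (s s' : ℕ → Tm) :
    (t.sub (liftSub s)).sub (consSub u s') = t.sub (consSub u (fun n => (s n).sub s')) := by
  rw [Tm.sub_sub]
  congr 1; funext n
  cases n with
  | zero => rfl
  | succ n => simp only [liftSub, Tm.sub_ren]; rfl

theorem Tm.sub_lift_ren_inst (t u : Tm) (s : ℕ → Tm) (ρ : ℕ → ℕ) :
    ((t.sub (liftSub s)).ren (liftRen ρ)).inst u =
      t.sub (consSub u (fun n => (s n).ren ρ)) := by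
  rw [Tm.ren_sub, liftSub_ren, Tm.inst, Tm.sub_lift_cons]
  simp only [Tm.sub_var]

theorem Tm.sub_lift_ren_inst₂ (v t u : Tm) (s : ℕ → Tm) (ρ : ℕ → ℕ) :
    ((v.sub (liftSub (liftSub s))).ren (liftRen (liftRen ρ))).inst₂ t u =
      v.sub (consSub u (consSub t (fun n => (s n).ren ρ))) := by
  rw [Tm.ren_sub, liftSub_ren, liftSub_ren, Tm.inst₂, Tm.sub_lift_cons]
  congr 2; funext n
  cases n with
  | zero => rfl
  | succ n => simp only [liftSub, Tm.sub_ren]; exact (Tm.ren_eq_sub _ _).symm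

/-- A neutral head applied to an argument is neutral only once the argument is normal; hence the
extra hypothesis `hu`, whose reduction sequence is absorbed by expansion. -/
theorem Cl.plug_app {P Q : Tm → Prop} {t u : Tm} (ht : Cl P t) (hu : ∀ ρ, WN (u.ren ρ))
    (hval : ∀ (ρ : ℕ → ℕ) (v : Tm), P v → Cl Q (.app v (u.ren ρ))) : Cl Q (.app t u) := by
  refine ht.plug (.app u) (fun ρ n hn => ?_) hval
  obtain ⟨u', hr, hu'⟩ := hu ρ
  suffices H : ∀ w, Relation.ReflTransGen (CongClosure Rule) w u' → Cl Q (.app n w) from H _ hr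
  intro w hw
  induction hw using Relation.ReflTransGen.head_induction_on with
  | refl => exact .ne (.app hn hu')
  | head hs _ ih => exact .expand (.appR n hs) ih

theorem Maps.inst {P Q : Tm → Prop} {a u : Tm} (h : Maps P Q a) (hu : P u) : Q (a.inst u) :=
  h id u hu

theorem RedSub.maps_lin {Γ : Ctx} {s : ℕ → Tm} (h : RedSub Γ s) {t : Tm} {τ σ : Ty}
    (ht : ∀ s, RedSub (.lin τ :: Γ) s → Red σ (t.sub s)) :
    Maps (Red τ) (Red σ) (t.sub (liftSub s)) := by
  intro ρ u hu
  rw [Tm.sub_lift_cons]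
  refine ht _ (RedSub.cons_lin ?_ hu)
  simpa only [Tm.ren_eq_sub] using h.ren ρ

theorem RedSub.maps_nonlin {Γ : Ctx} {s : ℕ → Tm} (h : RedSub Γ s) {t : Tm} {τ σ : Ty}
    (ht : ∀ s, RedSub (.nonlin τ :: Γ) s → Red σ (t.sub s)) :
    Maps (Red τ) (Red σ) (t.sub (liftSub s)) := by
  intro ρ u hu
  rw [Tm.sub_lift_cons]
  refine ht _ (RedSub.cons_nonlin ?_ hu)
  simpa only [Tm.ren_eq_sub] using h.ren ρ

/-- Induction on typing. Introduction rules yield values. Elimination rules go through `Cl.plug` or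
`Cl.plug_app`: over a neutral term the result is neutral or a node of the tree, and over a value it
β-reduces to a reducible term. -/
theorem Typed.red {Γ : Ctx} {t : Tm} {τ : Ty} (ht : Typed Γ t τ) {s : ℕ → Tm}
    (h : RedSub Γ s) : Red τ (t.sub s) := by
  induction ht generalizing s with
  | linVar hv => exact h _ _ (.inl hv.1)
  | nonlinVar hv => exact h _ _ (.inr hv.1)
  | lam _ ih => exact .val ⟨_, rfl, h.maps_lin fun _ => ih⟩
  | lamBang _ ih => exact .val ⟨_, rfl, h.maps_nonlin fun _ => ih⟩
  | linApp hs _ _ iht ihu =>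
    have hu := ihu (h.right hs)
    refine (iht (h.left hs)).plug_app (fun ρ => (hu.ren ρ).wn) ?_
    rintro ρ v ⟨a, rfl, ha⟩
    exact .beta (.lam _ _) (ha.inst (hu.ren ρ))
  | nonlinApp _ _ iht ihu =>
    have hu := ihu (h.right (Split.self_dropLin _))
    refine (iht h).plug_app (fun ρ => (hu.ren ρ).wn) ?_
    rintro ρ v ⟨a, rfl, ha⟩
    exact .beta (.lamBang _ _) (ha.inst (hu.ren ρ))
  | tens hs _ _ iht ihu => exact .val ⟨_, _, rfl, iht (h.left hs), ihu (h.right hs)⟩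
  | letTens hs _ _ iht ihu =>
    have hr := h.right hs
    refine (iht (h.left hs)).plug (.letIn .tens _) (fun ρ n hn => ?_) ?_
    -- The scrutinee is stuck, so the body is used with its bound variables left as variables, which
    -- are reducible because neutral.
    · exact .letIn _ hn (Red.ren (ihu ((hr.lift_lin _).lift_lin _)) _)
    · rintro ρ v ⟨a, b, rfl, ha, hb⟩
      refine .beta (.letTens _ _ _) ?_
      -- Renaming the frame and then substituting for the bound variables amounts to renaming `s`
      -- and extending it by the two components.
      have := ihu (((hr.ren ρ).cons_lin ha).cons_lin hb)
      rwa [← Tm.sub_lift_ren_inst₂] at this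
  | unit _ => exact .val rfl
  | letUnit hs _ _ iht ihu =>
    have hu := ihu (h.right hs)
    refine (iht (h.left hs)).plug (.letIn .unit _) (fun ρ n hn => ?_) ?_
    · exact .letIn _ hn (hu.ren ρ)
    · rintro ρ v rfl
      exact .beta (.letUnit _) (hu.ren ρ)
  | pair _ _ iht ihu => exact .val ⟨_, _, rfl, iht h, ihu h⟩
  | fst _ ih =>
    refine (ih h).plug (.proj .fst) (fun ρ n hn => .ne (.proj hn)) ?_
    rintro ρ v ⟨a, b, rfl, ha, -⟩
    exact .beta (.fst _ _) ha
  | snd _ ih =>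
    refine (ih h).plug (.proj .snd) (fun ρ n hn => .ne (.proj hn)) ?_
    rintro ρ v ⟨a, b, rfl, -, hb⟩
    exact .beta (.snd _ _) hb
  | inl _ ih => exact .val (.inl ⟨_, rfl, ih h⟩)
  | inr _ ih => exact .val (.inr ⟨_, rfl, ih h⟩)
  | caseOf hs _ _ _ iht ihu ihv =>
    have hr := h.right hs
    refine (iht (h.left hs)).plug (.caseOf _ _) (fun ρ n hn => ?_) ?_
    · exact .caseOf hn (Red.ren (ihu (hr.lift_lin _)) _) (Red.ren (ihv (hr.lift_lin _)) _)
    · rintro ρ v (⟨a, rfl, ha⟩ | ⟨a, rfl, ha⟩)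
      · refine .beta (.inl _ _ _) ?_
        rw [Tm.sub_lift_ren_inst]
        exact ihu ((hr.ren ρ).cons_lin ha)
      · refine .beta (.inr _ _ _) ?_
        rw [Tm.sub_lift_ren_inst]
        exact ihv ((hr.ren ρ).cons_lin ha)
  | triv => exact .val rfl
  | abort hs _ ih =>
    -- The type `0` has no values, so only neutral leaves remain.
    exact (ih (h.left hs)).plug .abort (fun ρ n hn => .ne (.abort hn)) fun _ _ hv => hv.elim

theorem Typed.wn {Γ : Ctx} {t : Tm} {τ : Ty} (ht : Typed Γ t τ) : WN t := by
  have h : Red τ (t.sub Tm.var) := ht.red fun n _ _ => .ne (.var n)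
  rw [Tm.sub_var] at h
  exact h.wn

end LamL

theorem mainTheorem10 (Γ : LamL.Ctx) (t : LamL.Tm) (τ : LamL.Ty) (ht : LamL.Typed Γ t τ) :
    ∃ t' : LamL.Tm, LamL.Reduces Γ τ t t' ∧ LamL.Norm LamL.Kind.nf Γ t' τ := by
  obtain ⟨t', hr, hs⟩ := ht.wn
  obtain ⟨hred, ht'⟩ := ht.reduces hr
  exact ⟨t', hred, hs.norm ht'⟩
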